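/- Let $X=[\underline x,\overline x]$, $Y=[\underline y,\overline y]$ with $\underline x<\overline x$, $\underline y<\overline y$, and let $F$, $G$ be cumulative distribution functions on $X$, $Y$ with continuous, strictly positive densities. For functions $\varphi,\psi$ on an interval $[l,u]$ write $\varphi\succeq\psi$ ("$\varphi$ majorizes $\psi$") if $\int_l^y\varphi\le\int_l^y\psi$ for all $y\in[l,u]$, with equality at $y=u$. Let $v:X\times Y\to\mathbb R$ be Lipschitz (for instance, twice continuously differentiable). An *assignment* is a Borel probability measure $J$ on $X\times Y$ whose $X$-marginal is $F$ and whose $Y$-marginal $J_Y$ has a distribution function that majorizes $G$. A *competitive equilibrium* $(J;p,q)$ is an assignment $J$ with Lipschitz functions $p:X\to\mathbb R$, $q:Y\to\mathbb R$ such that $p(x)+q(z)=v(x,z)$ on $\operatorname{supp}(J)$, $p(x)+q(z)\ge v(x,z)$ on $X\times Y$, $q$ is convex, and $\int q\,dJ_Y=\int q\,dG$. A map $T:X\to Y$ is an *equilibrium matching* if $\operatorname{supp}(J)=\{(x,T(x)):x\in X\}$ for some competitive equilibrium $(J;p,q)$. Let $S=G^{-1}\circ F$, and let $\mathcal T$ be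 the set of increasing, $1$-Lipschitz maps $T:X\to Y$ with $$\int_{\underline x}^{x}T\,dF\ \ge\ \int_{\underline x}^{x}S\,dF\quad\text{for all }x\in X,\ \text{with equality at }x=\overline x.$$ For $T\in\mathcal T$ let $X^C=\{x\in X:\int_{\underline x}^xT\,dF>\int_{\underline x}^xS\,dF\}$ be its compression set. For $t\in[0,1]$ let $E(t)=\int_0^t(F^{-1}(s)-G^{-1}(s))\,ds$, and let $\overline E:[0,1]\to\mathbb R$ be the largest convex function that lies below $E$. Suppose that $v(x,z)=a(z-x)+b(x)+cz$ on $X\times Y$ for some functions $a$, $b$ and a constant $c$, where $a$ is strictly concave on $[\underline y-\overline x,\overline y-\underline x]$ (the convex-loss case). Then there is exactly one equilibrium matching, every competitive equilibrium assignment has its graph as support, $\overline E$ is continuously differentiable on $[0,1]$ (one-sided at the end points) with derivative $\overline e=\overline E'$, and for every function $T$ on $X$ the following are equivalent: 0. $T$ is the equilibrium matching; 1. $T\in\mathcal T$, and $T'(x)=1$ for all $x\in X^C$; 2. $T(x)=x-\overline e(F(x))$ for all $x\in X$; 3. $T\in\mathcal T$, and $T\circ F^{-1}\succeq\tilde T\circ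 F^{-1}$ on $[0,1]$ for all $\tilde T\in\mathcal T$. -/

import Mathlib

open Set MeasureTheory

noncomputable section

namespace Matching

/-- A distribution of types on `[l, u]` with a continuous, strictly positive density. -/
structure TypeDist (l u : ℝ) where
  density : ℝ → ℝ
  continuousOn_density : ContinuousOn density (Icc l u)
  density_pos : ∀ x ∈ Icc l u, 0 < density x
  integral_density : ∫ x in l..u, density x = 1

namespace TypeDist

variable {l u : ℝ}

/-- The associated Borel measure on the line, concentrated on `[l, u]`. -/
def measure (F : TypeDist l u) : Measure ℝ :=
  (volume.restrict (Icc l u)).withDensity (fun x => ENNReal.ofReal (F.density x))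

/-- The distribution function. -/
def cdf (F : TypeDist l u) (x : ℝ) : ℝ := F.measure.real (Iic x)

/-- The inverse distribution function on `[0, 1]`, with values in `[l, u]`. -/
def quantile (F : TypeDist l u) (t : ℝ) : ℝ := sInf {x ∈ Icc l u | t ≤ F.cdf x}

end TypeDist

/-- `φ` majorizes `ψ` on `[l, u]`. -/
def Majorizes (l u : ℝ) (φ ψ : ℝ → ℝ) : Prop :=
  (∀ y ∈ Icc l u, ∫ s in l..y, φ s ≤ ∫ s in l..y, ψ s) ∧
    ∫ s in l..u, φ s = ∫ s in l..u, ψ s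

variable {xl xu yl yu : ℝ}

/-- An assignment: a distribution over pairs (firm type, mean skill of its workforce) on
`[xl, xu] × [yl, yu]` whose first marginal is `F` and whose second marginal majorizes `G`. -/
structure IsAssignment (F : TypeDist xl xu) (G : TypeDist yl yu) (J : Measure (ℝ × ℝ)) :
    Prop where
  isProbabilityMeasure : IsProbabilityMeasure J
  fst_eq : J.fst = F.measure
  snd_compl : J.snd (Icc yl yu)ᶜ = 0
  majorizes : Majorizes yl yu (fun y => J.snd.real (Iic y)) G.cdf

/-- `(J; p, q)` is a competitive equilibrium for the production function `v`. -/
structure IsCompetitiveEquilibrium (F : TypeDist xl xu) (G : TypeDist yl yu)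
    (v : ℝ → ℝ → ℝ) (J : Measure (ℝ × ℝ)) (p q : ℝ → ℝ) : Prop where
  isAssignment : IsAssignment F G J
  lipschitz_p : ∃ K, LipschitzOnWith K p (Icc xl xu)
  lipschitz_q : ∃ K, LipschitzOnWith K q (Icc yl yu)
  eq_on_support : ∀ w ∈ J.support, p w.1 + q w.2 = v w.1 w.2
  le_everywhere : ∀ x ∈ Icc xl xu, ∀ z ∈ Icc yl yu, v x z ≤ p x + q z
  convex_q : ConvexOn ℝ (Icc yl yu) q
  wages_eq : ∫ z, q z ∂J.snd = ∫ y, q y ∂G.measure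

/-- `T` is an equilibrium matching: in some competitive equilibrium, the pairs that form are
exactly the pairs `(x, T x)`, where `x` runs through the firm types. -/
def IsEquilibriumMatching (F : TypeDist xl xu) (G : TypeDist yl yu) (v : ℝ → ℝ → ℝ)
    (T : ℝ → ℝ) : Prop :=
  ∃ (J : Measure (ℝ × ℝ)) (p q : ℝ → ℝ), IsCompetitiveEquilibrium F G v J p q ∧
    J.support = (Icc xl xu).graphOn T

/-- The positive assortative segregation matching `S = G⁻¹ ∘ F`. -/
def pas (F : TypeDist xl xu) (G : TypeDist yl yu) (x : ℝ) : ℝ := G.quantile (F.cdf x)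

/-- The set of increasing, `1`-Lipschitz, feasible maps from `[xl, xu]` to `[yl, yu]`. -/
structure IsLipschitzMatching (F : TypeDist xl xu) (G : TypeDist yl yu) (T : ℝ → ℝ) :
    Prop where
  mapsTo : MapsTo T (Icc xl xu) (Icc yl yu)
  monotoneOn : MonotoneOn T (Icc xl xu)
  lipschitz : LipschitzOnWith 1 T (Icc xl xu)
  feasible_le : ∀ x ∈ Icc xl xu,
    ∫ s in Icc xl x, pas F G s ∂F.measure ≤ ∫ s in Icc xl x, T s ∂F.measure
  feasible_eq :
    ∫ s in Icc xl xu, T s ∂F.measure = ∫ s in Icc xl xu, pas F G s ∂F.measure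

/-- The compression set of a matching `T`. -/
def compressionSet (F : TypeDist xl xu) (G : TypeDist yl yu) (T : ℝ → ℝ) : Set ℝ :=
  {x ∈ Icc xl xu |
    ∫ s in Icc xl x, pas F G s ∂F.measure < ∫ s in Icc xl x, T s ∂F.measure}

/-- The integrated difference `E` of the two quantile functions. -/
def quantileGap (F : TypeDist xl xu) (G : TypeDist yl yu) (t : ℝ) : ℝ :=
  ∫ s in (0 : ℝ)..t, (F.quantile s - G.quantile s)

/-- The largest convex function on `[0, 1]` that lies below `E` there. -/
def convexEnvelope (E : ℝ → ℝ) (t : ℝ) : ℝ :=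
  sSup {r | ∃ φ : ℝ → ℝ, ConvexOn ℝ (Icc 0 1) φ ∧ (∀ s ∈ Icc (0 : ℝ) 1, φ s ≤ E s) ∧ r = φ t}

/-- The derivative on `[0, 1]` (one-sided at the end points) of the convex envelope of `E`. -/
def ironedGap (F : TypeDist xl xu) (G : TypeDist yl yu) (t : ℝ) : ℝ :=
  derivWithin (convexEnvelope (quantileGap F G)) (Icc 0 1) t

end Matching

end

/-! Pass to the quantile coordinate `t = F(x)` and replace a matching `T` by its gap `m(t) = F⁻¹(t)
- T(F⁻¹(t))`. The `1`-Lipschitz bound makes `m` increasing, so its primitive is convex; feasibility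
says that this primitive lies below `E`, with equality at `1`. Hence every primitive lies below the
convex envelope of `E`. The matching whose gap is the derivative `ē` of the envelope
(`ironedMatching`) has the largest primitive, that is, it is the most dispersed one. It is strictly
increasing because `ē` is constant off the contact set and equals `F⁻¹ - G⁻¹` at interior contact
points (`envelopeDeriv_sub_lt`).

Slope one on the compression set means that `m` is constant off the contact set of its own
primitive. A second mean value inequality and its equality case, applied to `g = ē - m`, then give
`∫ ē g ≤ 0` and `∫ m g = 0`, so `∫ g² ≤ 0` and `m = ē` (`eqOn_envelopeDeriv`).

For existence of an equilibrium (`exists_equilibrium`), let `θ` be the inverse of the ironed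
matching and `α` a decreasing density of `a`. The marginal wage `α(z - θ z) + c` is increasing,
because `z - θ z = -ē(F(θ z))` decreases; thus wages are convex, and each firm's marginal condition
holds at its partner. Marginal wages rise only across levels at which the integrated distribution
functions of `J_Y` and `G` agree, which gives the wage equality.

Uniqueness is linear programming duality: the prices of one equilibrium support the assignment of
every other (`eq_on_support_of_equilibrium`), and strict concavity of `a` against convex wages
leaves each firm type a single optimal partner (`partner_unique`). -/

noncomputable section

namespace Matching
-- Distribution functions and quantiles
namespace TypeDist

variable {l u : ℝ}

lemma setIntegral_measure (F : TypeDist l u) {s : Set ℝ} (hs : MeasurableSet s) (h : ℝ → ℝ) :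
    ∫ x in s, h x ∂F.measure = ∫ x in s ∩ Icc l u, F.density x * h x := by
  have hm : AEMeasurable (fun x => ENNReal.ofReal (F.density x))
      ((volume.restrict (Icc l u)).restrict s) :=
    ((F.continuousOn_density.aemeasurable measurableSet_Icc).ennreal_ofReal).restrict
  rw [measure, setIntegral_withDensity_eq_setIntegral_toReal_smul₀ hm
    (by simp) h hs, Measure.restrict_restrict hs]
  refine setIntegral_congr_fun (hs.inter measurableSet_Icc) fun x hx => ?_
  simp [ENNReal.toReal_ofReal (F.density_pos x hx.2).le]

lemma integrableOn_density (F : TypeDist l u) : IntegrableOn F.density (Icc l u) :=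
  F.continuousOn_density.integrableOn_Icc

lemma intervalIntegrable_density (F : TypeDist l u) {a b : ℝ} (ha : a ∈ Icc l u)
    (hb : b ∈ Icc l u) : IntervalIntegrable F.density volume a b :=
  (F.continuousOn_density.mono (uIcc_subset_Icc ha hb)).intervalIntegrable

instance (F : TypeDist l u) : IsFiniteMeasure F.measure := by
  have h := F.integrableOn_density.lintegral_lt_top
  exact isFiniteMeasure_withDensity h.ne

lemma measureReal_measure (F : TypeDist l u) {s : Set ℝ} (hs : MeasurableSet s) :
    F.measure.real s = ∫ x in s ∩ Icc l u, F.density x := by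
  have := F.setIntegral_measure hs (fun _ => 1)
  simpa using this

lemma measure_compl_Icc (F : TypeDist l u) : F.measure (Icc l u)ᶜ = 0 := by
  rw [measure, withDensity_apply _ measurableSet_Icc.compl,
    Measure.restrict_restrict measurableSet_Icc.compl]
  simp

lemma ae_mem_Icc (F : TypeDist l u) : ∀ᵐ x ∂F.measure, x ∈ Icc l u :=
  measure_eq_zero_iff_ae_notMem.1 F.measure_compl_Icc |>.mono fun _ hx => by simpa using hx

lemma restrict_Icc (F : TypeDist l u) : F.measure.restrict (Icc l u) = F.measure :=
  Measure.restrict_eq_self_of_ae_mem F.ae_mem_Icc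

/-- The distribution function as an integral of the density. -/
lemma cdf_eq_integral (F : TypeDist l u) {x : ℝ} (hx : x ∈ Icc l u) :
    F.cdf x = ∫ s in l..x, F.density s := by
  rw [cdf, F.measureReal_measure measurableSet_Iic, intervalIntegral.integral_of_le hx.1,
    ← integral_Icc_eq_integral_Ioc]
  congr 2
  ext y
  exact ⟨fun h => ⟨h.2.1, h.1⟩, fun h => ⟨h.2, h.1, h.2.trans hx.2⟩⟩

lemma cdf_of_le (F : TypeDist l u) (h : l < u) {x : ℝ} (hx : x ≤ l) : F.cdf x = 0 := by
  have h0 : F.cdf l = 0 := by simp [F.cdf_eq_integral (left_mem_Icc.2 h.le)]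
  refine le_antisymm ?_ measureReal_nonneg
  rw [← h0]
  exact measureReal_mono (Iic_subset_Iic.2 hx)

lemma cdf_left (F : TypeDist l u) (h : l < u) : F.cdf l = 0 := F.cdf_of_le h le_rfl

lemma cdf_right (F : TypeDist l u) (h : l < u) : F.cdf u = 1 := by
  rw [F.cdf_eq_integral (right_mem_Icc.2 h.le), F.integral_density]

lemma measureReal_univ (F : TypeDist l u) (h : l < u) : F.measure.real univ = 1 := by
  rw [F.measureReal_measure MeasurableSet.univ, univ_inter, integral_Icc_eq_integral_Ioc,
    ← intervalIntegral.integral_of_le h.le, F.integral_density]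

lemma isProbabilityMeasure (F : TypeDist l u) (h : l < u) : IsProbabilityMeasure F.measure := by
  constructor
  have := F.measureReal_univ h
  rw [measureReal_def] at this
  rw [← ENNReal.ofReal_toReal (measure_ne_top F.measure univ), this, ENNReal.ofReal_one]

lemma cdf_monotone (F : TypeDist l u) : Monotone F.cdf :=
  fun _ _ hab => measureReal_mono (Iic_subset_Iic.2 hab)

lemma cdf_of_ge (F : TypeDist l u) (h : l < u) {x : ℝ} (hx : u ≤ x) : F.cdf x = 1 := by
  refine le_antisymm ?_ ?_
  · rw [← F.measureReal_univ h]; exact measureReal_mono (subset_univ _)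
  · rw [← F.cdf_right h]; exact F.cdf_monotone hx

lemma cdf_mem_Icc (F : TypeDist l u) (h : l < u) (x : ℝ) : F.cdf x ∈ Icc (0 : ℝ) 1 := by
  refine ⟨measureReal_nonneg, ?_⟩
  rw [← F.measureReal_univ h]; exact measureReal_mono (subset_univ _)

lemma cdf_sub (F : TypeDist l u) {x y : ℝ} (hx : x ∈ Icc l u) (hy : y ∈ Icc l u) :
    F.cdf y - F.cdf x = ∫ s in x..y, F.density s := by
  have hl : l ∈ Icc l u := ⟨le_rfl, hx.1.trans hx.2⟩
  rw [F.cdf_eq_integral hx, F.cdf_eq_integral hy]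
  exact intervalIntegral.integral_interval_sub_left (F.intervalIntegrable_density hl hy)
    (F.intervalIntegrable_density hl hx)

lemma cdf_strictMonoOn (F : TypeDist l u) : StrictMonoOn F.cdf (Icc l u) := by
  intro x hx y hy hxy
  have := intervalIntegral.intervalIntegral_pos_of_pos_on (F.intervalIntegrable_density hx hy)
    (fun s hs => F.density_pos s ⟨hx.1.trans hs.1.le, hs.2.le.trans hy.2⟩) hxy
  rw [← F.cdf_sub hx hy] at this
  linarith

lemma cdf_continuousOn (F : TypeDist l u) (h : l < u) : ContinuousOn F.cdf (Icc l u) := by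
  have := intervalIntegral.continuousOn_primitive_interval
    (μ := volume) (f := F.density) (a := l) (b := u) (by
      rw [uIcc_of_le h.le]; exact F.integrableOn_density)
  rw [uIcc_of_le h.le] at this
  exact this.congr fun x hx => F.cdf_eq_integral hx

lemma cdf_eq_cdf_projIcc (F : TypeDist l u) (h : l < u) (x : ℝ) :
    F.cdf x = F.cdf (projIcc l u h.le x) := by
  rcases le_total x l with hx | hx
  · rw [projIcc_of_le_left _ hx, F.cdf_of_le h hx, F.cdf_left h]
  rcases le_total x u with hx' | hx'
  · rw [projIcc_of_mem _ ⟨hx, hx'⟩]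
  · rw [projIcc_of_right_le _ hx', F.cdf_of_ge h hx', F.cdf_right h]

lemma cdf_continuous (F : TypeDist l u) (h : l < u) : Continuous F.cdf := by
  have h1 : Continuous (IccExtend h.le ((Icc l u).domRestrict F.cdf)) :=
    (F.cdf_continuousOn h).domRestrict.Icc_extend'
  refine h1.congr fun x => ?_
  rw [F.cdf_eq_cdf_projIcc h x]
  rfl

lemma cdf_hasDerivAt (F : TypeDist l u) {x : ℝ} (hx : x ∈ Ioo l u) :
    HasDerivAt F.cdf (F.density x) x := by
  have hl : l ∈ Icc l u := ⟨le_rfl, (hx.1.trans hx.2).le⟩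
  have h1 : HasDerivAt (fun y => ∫ s in l..y, F.density s) (F.density x) x :=
    intervalIntegral.integral_hasDerivAt_right
      (F.intervalIntegrable_density hl (Ioo_subset_Icc_self hx))
      ((F.continuousOn_density.mono Ioo_subset_Icc_self).stronglyMeasurableAtFilter isOpen_Ioo x hx)
      (F.continuousOn_density.continuousAt (Icc_mem_nhds hx.1 hx.2))
  refine h1.congr_of_eventuallyEq ?_
  filter_upwards [Icc_mem_nhds hx.1 hx.2] with y hy using F.cdf_eq_integral hy

lemma exists_cdf_eq (F : TypeDist l u) (h : l < u) {t : ℝ} (ht : t ∈ Icc (0 : ℝ) 1) :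
    ∃ x ∈ Icc l u, F.cdf x = t := by
  have := intermediate_value_Icc h.le (F.cdf_continuousOn h)
  rw [F.cdf_left h, F.cdf_right h] at this
  exact this ht

lemma quantile_cdf (F : TypeDist l u) {x : ℝ} (hx : x ∈ Icc l u) :
    F.quantile (F.cdf x) = x := by
  have : IsLeast {y ∈ Icc l u | F.cdf x ≤ F.cdf y} x :=
    ⟨⟨hx, le_rfl⟩, fun y hy => (F.cdf_strictMonoOn.le_iff_le hx hy.1).1 hy.2⟩
  exact this.csInf_eq

lemma quantile_mem (F : TypeDist l u) (h : l < u) {t : ℝ} (ht : t ∈ Icc (0 : ℝ) 1) :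
    F.quantile t ∈ Icc l u := by
  obtain ⟨x, hx, rfl⟩ := F.exists_cdf_eq h ht
  rwa [F.quantile_cdf hx]

lemma cdf_quantile (F : TypeDist l u) (h : l < u) {t : ℝ} (ht : t ∈ Icc (0 : ℝ) 1) :
    F.cdf (F.quantile t) = t := by
  obtain ⟨x, hx, rfl⟩ := F.exists_cdf_eq h ht
  rw [F.quantile_cdf hx]

lemma quantile_zero (F : TypeDist l u) (h : l < u) : F.quantile 0 = l := by
  rw [← F.cdf_left h, F.quantile_cdf (left_mem_Icc.2 h.le)]

lemma quantile_one (F : TypeDist l u) (h : l < u) : F.quantile 1 = u := by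
  rw [← F.cdf_right h, F.quantile_cdf (right_mem_Icc.2 h.le)]

lemma quantile_strictMonoOn (F : TypeDist l u) (h : l < u) :
    StrictMonoOn F.quantile (Icc 0 1) := by
  intro s hs t ht hst
  obtain ⟨x, hx, rfl⟩ := F.exists_cdf_eq h hs
  obtain ⟨y, hy, rfl⟩ := F.exists_cdf_eq h ht
  rw [F.quantile_cdf hx, F.quantile_cdf hy]
  exact (F.cdf_strictMonoOn.lt_iff_lt hx hy).1 hst

lemma quantile_image (F : TypeDist l u) (h : l < u) : F.quantile '' Icc 0 1 = Icc l u := by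
  refine Subset.antisymm (image_subset_iff.2 fun t ht => F.quantile_mem h ht) fun x hx => ?_
  exact ⟨F.cdf x, F.cdf_mem_Icc h x, F.quantile_cdf hx⟩

end TypeDist

/-- A monotone function on a compact interval whose image is an interval is continuous. -/
lemma _root_.MonotoneOn.continuousOn_of_ordConnected_image {a b : ℝ} {f : ℝ → ℝ}
    (hf : MonotoneOn f (Icc a b)) (hi : OrdConnected (f '' Icc a b)) :
    ContinuousOn f (Icc a b) := by
  have hi' : OrdConnected (range ((Icc a b).domRestrict f)) := by rwa [range_domRestrict]
  have h1 : Continuous (rangeFactorization ((Icc a b).domRestrict f)) := by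
    refine Monotone.continuous_of_surjective ?_ rangeFactorization_surjective
    intro x y hxy
    exact hf x.2 y.2 hxy
  rw [continuousOn_iff_continuous_domRestrict]
  exact continuous_subtype_val.comp h1

namespace TypeDist
variable {l u : ℝ}

lemma quantile_continuousOn (F : TypeDist l u) (h : l < u) :
    ContinuousOn F.quantile (Icc 0 1) :=
  (F.quantile_strictMonoOn h).monotoneOn.continuousOn_of_ordConnected_image
    (by rw [F.quantile_image h]; exact ordConnected_Icc)

/-- Substitution `t = F.cdf s`. Since the density is nonnegative, the change of variables needs no
regularity of `φ`, so the feasibility integrals of an arbitrary map can be moved to the unit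
interval. -/
lemma setIntegral_Icc_measure (F : TypeDist l u) (h : l < u) (φ : ℝ → ℝ) {x : ℝ}
    (hx : x ∈ Icc l u) :
    ∫ s in Icc l x, φ s ∂F.measure = ∫ t in (0 : ℝ)..F.cdf x, φ (F.quantile t) := by
  have hsub : Icc l x ⊆ Icc l u := Icc_subset_Icc_right hx.2
  rw [F.setIntegral_measure measurableSet_Icc, inter_eq_left.2 hsub,
    integral_Icc_eq_integral_Ioc, ← intervalIntegral.integral_of_le hx.1]
  have h1 := intervalIntegral.integral_comp_mul_deriv_of_deriv_nonneg (a := l) (b := x)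
    (f := F.cdf) (f' := F.density) (g := fun t => φ (F.quantile t))
    (F.cdf_continuous h).continuousOn
    (fun y hy => F.cdf_hasDerivAt (by
      rw [min_eq_left hx.1, max_eq_right hx.1] at hy
      exact ⟨hy.1, hy.2.trans_le hx.2⟩))
    (fun y hy => (F.density_pos y (by
      rw [min_eq_left hx.1, max_eq_right hx.1] at hy
      exact ⟨hy.1.le, hy.2.le.trans hx.2⟩)).le)
  rw [F.cdf_left h] at h1
  rw [← h1]
  refine intervalIntegral.integral_congr fun s hs => ?_
  rw [uIcc_of_le hx.1] at hs
  simp only [Function.comp_apply, F.quantile_cdf (hsub hs)]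
  ring

lemma integral_measure_eq (F : TypeDist l u) (h : l < u) (φ : ℝ → ℝ) :
    ∫ s, φ s ∂F.measure = ∫ t in (0 : ℝ)..1, φ (F.quantile t) := by
  rw [← F.cdf_right h, ← F.setIntegral_Icc_measure h φ (right_mem_Icc.2 h.le), F.restrict_Icc]

lemma measure_pos_of_isOpen (F : TypeDist l u) (h : l < u) {U : Set ℝ} (hU : IsOpen U)
    {x : ℝ} (hx : x ∈ Icc l u) (hxU : x ∈ U) : 0 < F.measure U := by
  obtain ⟨ε, hε, hsub⟩ := Metric.isOpen_iff.1 hU x hxU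
  have key : ∀ a b : ℝ, a ∈ Icc l u → b ∈ Icc l u → a < b → Ioc a b ⊆ U → 0 < F.measure U := by
    intro a b ha hb hab hs
    have h1 : 0 < F.measure.real (Ioc a b) := by
      have h2 : Iic b \ Iic a = Ioc a b := by ext; simp [and_comm]
      have h3 := measureReal_sdiff (μ := F.measure) (Iic_subset_Iic.2 hab.le) measurableSet_Iic
      rw [h2] at h3
      have := F.cdf_strictMonoOn ha hb hab
      rw [h3]
      exact sub_pos.2 this
    have h2 : F.measure (Ioc a b) ≠ 0 := fun h0 => by simp [measureReal_def, h0] at h1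
    exact (pos_iff_ne_zero.2 h2).trans_le (measure_mono hs)
  -- Mass is sought to the right of `x`, except at `x = u`, where only the left side lies in `[l,
  -- u]`.
  rcases lt_or_ge x u with hxu | hxu
  · refine key x (min u (x + ε / 2)) hx ⟨?_, min_le_left _ _⟩ (lt_min hxu (by linarith)) ?_
    · exact le_min h.le (by linarith [hx.1])
    · intro y hy
      have : y ≤ x + ε / 2 := hy.2.trans (min_le_right _ _)
      apply hsub
      rw [Metric.mem_ball, Real.dist_eq, abs_lt]
      constructor <;> linarith [hy.1]
  · have hxu : x = u := le_antisymm hx.2 hxu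
    refine key (max l (x - ε / 2)) x ⟨le_max_left _ _, ?_⟩ hx
      (max_lt (by linarith) (by linarith)) ?_
    · exact max_le h.le (by linarith)
    · intro y hy
      have : x - ε / 2 < y := (le_max_right _ _).trans_lt hy.1
      apply hsub
      rw [Metric.mem_ball, Real.dist_eq, abs_lt]
      constructor <;> linarith [hy.2]

end TypeDist
-- Monotone weights: primitives and second mean value inequalities
lemma intervalIntegrable_of_monotoneOn_Icc {m : ℝ → ℝ} {a b : ℝ} (hm : MonotoneOn m (Icc a b))
    {x y : ℝ} (hx : x ∈ Icc a b) (hy : y ∈ Icc a b) : IntervalIntegrable m volume x y :=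
  (hm.mono (uIcc_subset_Icc hx hy)).intervalIntegrable

lemma integral_sub_eq_of_monotoneOn {m : ℝ → ℝ} {a b : ℝ} (hm : MonotoneOn m (Icc a b))
    {x y : ℝ} (hx : x ∈ Icc a b) (hy : y ∈ Icc a b) :
    (∫ s in a..y, m s) - ∫ s in a..x, m s = ∫ s in x..y, m s := by
  have ha : a ∈ Icc a b := ⟨le_rfl, hx.1.trans hx.2⟩
  exact intervalIntegral.integral_interval_sub_left
    (intervalIntegrable_of_monotoneOn_Icc hm ha hy) (intervalIntegrable_of_monotoneOn_Icc hm ha hx)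

lemma integral_le_of_monotoneOn {m : ℝ → ℝ} {a b : ℝ} (hm : MonotoneOn m (Icc a b))
    {x y : ℝ} (hx : x ∈ Icc a b) (hy : y ∈ Icc a b) (hxy : x ≤ y) :
    ∫ s in x..y, m s ≤ m y * (y - x) := by
  have := intervalIntegral.integral_mono_on hxy (intervalIntegrable_of_monotoneOn_Icc hm hx hy)
    intervalIntegrable_const (g := fun _ => m y)
    (fun s hs => hm ⟨hx.1.trans hs.1, hs.2.trans hy.2⟩ hy hs.2)
  simpa [mul_comm] using this

lemma le_integral_of_monotoneOn {m : ℝ → ℝ} {a b : ℝ} (hm : MonotoneOn m (Icc a b))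
    {x y : ℝ} (hx : x ∈ Icc a b) (hy : y ∈ Icc a b) (hxy : x ≤ y) :
    m x * (y - x) ≤ ∫ s in x..y, m s := by
  have := intervalIntegral.integral_mono_on hxy intervalIntegrable_const
    (intervalIntegrable_of_monotoneOn_Icc hm hx hy) (f := fun _ => m x)
    (fun s hs => hm hx ⟨hx.1.trans hs.1, hs.2.trans hy.2⟩ hs.1)
  simpa [mul_comm] using this

/-- A primitive of a monotone function is convex. -/
lemma convexOn_primitive_of_monotoneOn {m : ℝ → ℝ} {a b : ℝ} (hm : MonotoneOn m (Icc a b)) :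
    ConvexOn ℝ (Icc a b) (fun x => ∫ s in a..x, m s) := by
  refine convexOn_of_slope_mono_adjacent (convex_Icc a b) ?_
  intro x y z hx hz hxy hyz
  have hy : y ∈ Icc a b := ⟨hx.1.trans hxy.le, hyz.le.trans hz.2⟩
  rw [integral_sub_eq_of_monotoneOn hm hx hy, integral_sub_eq_of_monotoneOn hm hy hz]
  calc (∫ s in x..y, m s) / (y - x) ≤ m y := by
        rw [div_le_iff₀ (sub_pos.2 hxy)]; exact integral_le_of_monotoneOn hm hx hy hxy.le
    _ ≤ (∫ s in y..z, m s) / (z - y) := by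
        rw [le_div_iff₀ (sub_pos.2 hyz)]; exact le_integral_of_monotoneOn hm hy hz hyz.le

/-- If the increments of `V` are of second order, controlled by those of `m`, then `V` does not
increase. -/
lemma le_of_increment_le {V m : ℝ → ℝ} {a b C : ℝ} (hab : a ≤ b)
    (hV : ∀ y ∈ Icc a b, ∀ z ∈ Icc a b, y ≤ z → V z - V y ≤ C * (z - y) * (m z - m y)) :
    V b ≤ V a := by
  -- On `n + 1` equal pieces the increments of both `V` and `m` telescope, leaving an error of order
  -- `1 / (n + 1)`. No continuity of `V` or `m` is needed.
  have key : ∀ n : ℕ, V b - V a ≤ C * (b - a) * (m b - m a) / ((n : ℝ) + 1) := by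
    intro n
    have hn : (0 : ℝ) < (n : ℝ) + 1 := by positivity
    set x : ℕ → ℝ := fun i => a + i * ((b - a) / (n + 1)) with hx
    have hstep : 0 ≤ (b - a) / ((n : ℝ) + 1) := div_nonneg (sub_nonneg.2 hab) hn.le
    have h0 : x 0 = a := by simp [hx]
    have hN : x (n + 1) = b := by
      simp only [hx]; push_cast; field_simp; ring
    have hmono : Monotone x := by
      intro i j hij
      simp only [hx]
      have : (i : ℝ) ≤ j := by exact_mod_cast hij
      nlinarith
    have hmem : ∀ i ≤ n + 1, x i ∈ Icc a b := fun i hi =>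
      ⟨h0 ▸ hmono (Nat.zero_le i), hN ▸ hmono hi⟩
    have hsum : ∑ i ∈ Finset.range (n + 1), (V (x (i + 1)) - V (x i)) ≤
        ∑ i ∈ Finset.range (n + 1),
          C * ((b - a) / (n + 1)) * (m (x (i + 1)) - m (x i)) := by
      refine Finset.sum_le_sum fun i hi => ?_
      have hi' := Finset.mem_range.1 hi
      have h1 := hV (x i) (hmem i (by omega)) (x (i + 1)) (hmem (i + 1) (by omega))
        (hmono (Nat.le_succ i))
      have h2 : x (i + 1) - x i = (b - a) / (n + 1) := by
        simp only [hx]; push_cast; ring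
      rwa [h2] at h1
    rw [← Finset.mul_sum, Finset.sum_range_sub (fun i => V (x i)),
      Finset.sum_range_sub (fun i => m (x i)), h0, hN] at hsum
    calc V b - V a ≤ _ := hsum
      _ = _ := by ring
  have hlim : Filter.Tendsto (fun n : ℕ => C * (b - a) * (m b - m a) / ((n : ℝ) + 1))
      Filter.atTop (nhds 0) := by
    have := (tendsto_const_div_atTop_nhds_zero_nat (C * (b - a) * (m b - m a))).comp
      (Filter.tendsto_add_atTop_nat 1)
    refine this.congr fun n => ?_
    simp
  linarith [ge_of_tendsto' hlim key]

section SecondMeanValue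

variable {m g : ℝ → ℝ} {a b C : ℝ}

lemma intervalIntegrable_monotoneOn_mul (hm : MonotoneOn m (Icc a b))
    (hg : IntegrableOn g (Icc a b)) {y z : ℝ} (hy : y ∈ Icc a b) (hz : z ∈ Icc a b) :
    IntervalIntegrable (fun s => m s * g s) volume y z := by
  have h1 : IntegrableOn (fun s => m s * g s) (Icc a b) := by
    refine Integrable.bdd_mul (c := max |m a| |m b|) hg
      (aemeasurable_restrict_of_monotoneOn measurableSet_Icc hm).aestronglyMeasurable ?_
    refine (ae_restrict_mem measurableSet_Icc).mono fun s hs => ?_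
    have hab : a ≤ b := hs.1.trans hs.2
    exact abs_le_max_abs_abs (hm ⟨le_rfl, hab⟩ hs hs.1) (hm hs ⟨hab, le_rfl⟩ hs.2)
  exact (h1.mono_set (uIcc_subset_Icc hy hz)).intervalIntegrable

/-- On `[y, z]` freezing the weight at `m y` costs at most `m z - m y` pointwise. The resulting
error has the second-order form required by `le_of_increment_le`; this replaces Stieltjes
integration by parts, so `m` may jump. -/
lemma integral_monotoneOn_mul_increment (hm : MonotoneOn m (Icc a b))
    (hg : IntegrableOn g (Icc a b)) (hC : ∀ s ∈ Icc a b, |g s| ≤ C) {y z : ℝ}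
    (hy : y ∈ Icc a b) (hz : z ∈ Icc a b) (hyz : y ≤ z) :
    |(∫ s in a..z, m s * g s) - (∫ s in a..y, m s * g s) -
      m y * ((∫ s in a..z, g s) - ∫ s in a..y, g s)| ≤ C * (z - y) * (m z - m y) := by
  have ha : a ∈ Icc a b := ⟨le_rfl, hy.1.trans hy.2⟩
  have hgi : ∀ {y z}, y ∈ Icc a b → z ∈ Icc a b → IntervalIntegrable g volume y z :=
    fun hy hz => (hg.mono_set (uIcc_subset_Icc hy hz)).intervalIntegrable
  rw [intervalIntegral.integral_interval_sub_left (intervalIntegrable_monotoneOn_mul hm hg ha hz)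
    (intervalIntegrable_monotoneOn_mul hm hg ha hy),
    intervalIntegral.integral_interval_sub_left (hgi ha hz) (hgi ha hy),
    ← intervalIntegral.integral_const_mul,
    ← intervalIntegral.integral_sub (intervalIntegrable_monotoneOn_mul hm hg hy hz)
      ((hgi hy hz).const_mul _)]
  have hC0 : 0 ≤ C := (abs_nonneg _).trans (hC y hy)
  have := intervalIntegral.norm_integral_le_of_norm_le_const (a := y) (b := z)
    (f := fun s => m s * g s - m y * g s) (C := C * (m z - m y)) (by
      intro s hs
      rw [uIoc_of_le hyz] at hs
      have hsI : s ∈ Icc a b := ⟨hy.1.trans hs.1.le, hs.2.trans hz.2⟩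
      rw [Real.norm_eq_abs, ← sub_mul, abs_mul, mul_comm C]
      have h1 := hm hy hsI hs.1.le
      have h2 := hm hsI hz hs.2
      rw [abs_of_nonneg (by linarith)]
      exact mul_le_mul (by linarith) (hC s hsI) (abs_nonneg _) (by linarith))
  rw [Real.norm_eq_abs, abs_of_nonneg (sub_nonneg.2 hyz)] at this
  linarith

/-- A second mean value inequality: integrating a monotone weight against a density with
nonnegative primitive. -/
lemma integral_monotoneOn_mul_le (hab : a ≤ b) (hm : MonotoneOn m (Icc a b))
    (hg : IntegrableOn g (Icc a b)) (hC : ∀ s ∈ Icc a b, |g s| ≤ C)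
    (hpos : ∀ y ∈ Icc a b, 0 ≤ ∫ s in a..y, g s) :
    ∫ s in a..b, m s * g s ≤ m b * ∫ s in a..b, g s := by
  -- Formally `dV = -(∫ g) dm ≤ 0`, and `V a = 0`.
  have := le_of_increment_le (C := C) (m := m) hab
    (V := fun y => (∫ s in a..y, m s * g s) - m y * ∫ s in a..y, g s) (by
      intro y hy z hz hyz
      have h1 := (abs_le.1 (integral_monotoneOn_mul_increment hm hg hC hy hz hyz)).2
      have h2 := mul_nonneg (sub_nonneg.2 (hm hy hz hyz)) (hpos z hz)
      linarith)
  simp only [intervalIntegral.integral_same, mul_zero, sub_zero] at this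
  linarith

/-- The equality case: the weight only increases across zeros of the primitive. -/
lemma integral_monotoneOn_mul_eq (hab : a ≤ b) (hm : MonotoneOn m (Icc a b))
    (hg : IntegrableOn g (Icc a b)) (hC : ∀ s ∈ Icc a b, |g s| ≤ C)
    (hpos : ∀ y ∈ Icc a b, 0 ≤ ∫ s in a..y, g s)
    (hzero : ∀ y ∈ Icc a b, ∀ z ∈ Icc a b, y < z → m y ≠ m z →
      ∃ k ∈ Icc y z, ∫ s in a..k, g s = 0) :
    ∫ s in a..b, m s * g s = m b * ∫ s in a..b, g s := by
  refine le_antisymm (integral_monotoneOn_mul_le hab hm hg hC hpos) ?_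
  have := le_of_increment_le (C := 2 * C) (m := m) hab
    (V := fun y => m y * (∫ s in a..y, g s) - ∫ s in a..y, m s * g s) (by
      intro y hy z hz hyz
      have h1 := (abs_le.1 (integral_monotoneOn_mul_increment hm hg hC hy hz hyz)).1
      -- Where `m` changes, the primitive of `g` has a zero in `[y, z]`, so it is at most `C * (z -
      -- y)` at `z`; the term is again of second order.
      have h2 : (m z - m y) * (∫ s in a..z, g s) ≤ C * (z - y) * (m z - m y) := by
        by_cases hmyz : m y = m z
        · simp [hmyz]
        have hlt : y < z := lt_of_le_of_ne hyz fun h => hmyz (by rw [h])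
        obtain ⟨k, hk, hk0⟩ := hzero y hy z hz hlt hmyz
        have ha : a ∈ Icc a b := ⟨le_rfl, hab⟩
        have hkI : k ∈ Icc a b := ⟨hy.1.trans hk.1, hk.2.trans hz.2⟩
        have hgi : ∀ {y z}, y ∈ Icc a b → z ∈ Icc a b → IntervalIntegrable g volume y z :=
          fun hy hz => (hg.mono_set (uIcc_subset_Icc hy hz)).intervalIntegrable
        have h3 : ∫ s in a..z, g s = ∫ s in k..z, g s := by
          rw [← intervalIntegral.integral_add_adjacent_intervals (hgi ha hkI) (hgi hkI hz), hk0,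
            zero_add]
        have h4 := intervalIntegral.norm_integral_le_of_norm_le_const (a := k) (b := z)
          (f := g) (C := C) (by
            intro s hs
            rw [uIoc_of_le hk.2] at hs
            exact hC s ⟨hkI.1.trans hs.1.le, hs.2.trans hz.2⟩)
        rw [Real.norm_eq_abs, abs_of_nonneg (sub_nonneg.2 hk.2)] at h4
        have h5 : (∫ s in a..z, g s) ≤ C * (z - y) := by
          have hC0 : 0 ≤ C := (abs_nonneg _).trans (hC y hy)
          rw [h3]
          refine (le_abs_self _).trans (h4.trans ?_)
          exact mul_le_mul_of_nonneg_left (by linarith [hk.1]) hC0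
        have := mul_le_mul_of_nonneg_left h5 (sub_nonneg.2 (hm hy hz hyz))
        linarith
      linarith)
  simp only [intervalIntegral.integral_same, mul_zero, sub_zero] at this
  linarith

end SecondMeanValue

/-- A Lipschitz convex function on a compact interval is the primitive of a bounded monotone
function. -/
lemma exists_monotone_primitive_of_convexOn {f : ℝ → ℝ} {l u : ℝ} {K : NNReal} (hlu : l < u)
    (hf : ConvexOn ℝ (Icc l u) f) (hK : LipschitzOnWith K f (Icc l u)) :
    ∃ m : ℝ → ℝ, Monotone m ∧ (∀ x, |m x| ≤ K) ∧
      ∀ s ∈ Icc l u, ∀ t ∈ Icc l u, f t - f s = ∫ x in s..t, m x := by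
  have hslope : ∀ x ∈ Icc l u, ∀ y ∈ Icc l u, x < y → |slope f x y| ≤ K := by
    intro x hx y hy hxy
    have := hK.dist_le_mul y hy x hx
    rw [Real.dist_eq, Real.dist_eq, abs_of_pos (sub_pos.2 hxy)] at this
    rw [slope_def_field, abs_div, abs_of_pos (sub_pos.2 hxy), div_le_iff₀ (sub_pos.2 hxy)]
    exact this
  have hbd : ∀ x ∈ Ioo l u, |derivWithin f (Ioi x) x| ≤ K := by
    intro x hx
    have hxI := Ioo_subset_Icc_self hx
    have hxi : x ∈ interior (Icc l u) := by rwa [interior_Icc]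
    have hl : l ∈ Icc l u := left_mem_Icc.2 hlu.le
    have hu : u ∈ Icc l u := right_mem_Icc.2 hlu.le
    rw [abs_le]
    constructor
    · have h1 := (abs_le.1 (hslope l hl x hxI hx.1)).1
      have h2 := hf.slope_le_leftDeriv_of_mem_interior hl hxi hx.1
      have h3 := hf.leftDeriv_le_rightDeriv_of_mem_interior hxi
      linarith
    · have h1 := (abs_le.1 (hslope x hxI u hu hx.2)).2
      have h2 := hf.rightDeriv_le_slope_of_mem_interior hxi hu hx.2
      linarith
  -- The right derivative is only controlled in the interior; the values `∓K` elsewhere keep `m`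
  -- monotone and bounded on the whole line.
  set m : ℝ → ℝ := fun x => if x ≤ l then -K else if u ≤ x then K else derivWithin f (Ioi x) x
    with hm
  have hmI : ∀ x ∈ Ioo l u, m x = derivWithin f (Ioi x) x := fun x hx => by
    simp [hm, not_le.2 hx.1, not_le.2 hx.2]
  have hmono : Monotone m := by
    intro x y hxy
    have hK0 : (0 : ℝ) ≤ K := K.2
    by_cases hx : x ≤ l
    · simp only [hm, hx, if_true]
      split_ifs with h1 h2
      · exact le_rfl
      · linarith
      · exact (abs_le.1 (hbd y ⟨not_le.1 h1, not_le.1 h2⟩)).1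
    · have hy : ¬ y ≤ l := fun h => hx (hxy.trans h)
      by_cases hy' : u ≤ y
      · simp only [hm, hx, hy, hy', if_true, if_false]
        split_ifs with h1
        · exact le_rfl
        · exact (abs_le.1 (hbd x ⟨not_le.1 hx, not_le.1 h1⟩)).2
      · have hxI : x ∈ Ioo l u := ⟨not_le.1 hx, hxy.trans_lt (not_le.1 hy')⟩
        have hyI : y ∈ Ioo l u := ⟨not_le.1 hy, not_le.1 hy'⟩
        rw [hmI x hxI, hmI y hyI]
        have := hf.monotoneOn_rightDeriv
        rw [interior_Icc] at this
        exact this hxI hyI hxy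
  refine ⟨m, hmono, fun x => ?_, fun s hs t ht => ?_⟩
  · have hK0 : (0 : ℝ) ≤ K := K.2
    simp only [hm]
    split_ifs with h1 h2
    · simp
    · simp
    · exact hbd x ⟨not_le.1 h1, not_le.1 h2⟩
  · have hsub : uIcc s t ⊆ Icc l u := uIcc_subset_Icc hs ht
    symm
    refine intervalIntegral.integral_eq_sub_of_hasDeriv_right (hK.continuousOn.mono hsub)
      (fun x hx => ?_) hmono.intervalIntegrable
    have hxI : x ∈ Ioo l u :=
      ⟨(le_min hs.1 ht.1).trans_lt hx.1, hx.2.trans_le (max_le hs.2 ht.2)⟩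
    rw [hmI x hxI]
    exact hf.hasDerivWithinAt_rightDeriv_of_mem_interior (by rwa [interior_Icc])

/-! ### The convex envelope and its derivative -/

lemma convexOn_affine (s : Set ℝ) (hs : Convex ℝ s) (A B : ℝ) :
    ConvexOn ℝ s (fun t => A + B * t) := by
  refine ⟨hs, fun x _ y _ a b _ _ hab => le_of_eq ?_⟩
  simp only [smul_eq_mul]
  obtain rfl : b = 1 - a := by linarith
  ring

lemma exists_abs_sub_le {E e : ℝ → ℝ} (he : ContinuousOn e (Icc 0 1))
    (hE : ∀ t ∈ Icc (0 : ℝ) 1, HasDerivWithinAt E (e t) (Icc 0 1) t) :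
    ∃ K, 0 ≤ K ∧ ∀ s ∈ Icc (0 : ℝ) 1, ∀ t ∈ Icc (0 : ℝ) 1, |E t - E s| ≤ K * |t - s| := by
  obtain ⟨K, hK⟩ := isCompact_Icc.exists_bound_of_continuousOn he
  refine ⟨K, (norm_nonneg _).trans (hK 0 (by simp)), fun s hs t ht => ?_⟩
  exact (convex_Icc (0 : ℝ) 1).norm_image_sub_le_of_norm_hasDerivWithin_le hE hK hs ht

section Envelope

variable {E : ℝ → ℝ} {K : ℝ}

/-- `E t` bounds the set of competing values, so the real `sSup` is a genuine supremum rather than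
its default value `0`. -/
lemma le_convexEnvelope {φ : ℝ → ℝ} (hφ : ConvexOn ℝ (Icc 0 1) φ)
    (hle : ∀ s ∈ Icc (0 : ℝ) 1, φ s ≤ E s) {t : ℝ} (ht : t ∈ Icc (0 : ℝ) 1) :
    φ t ≤ convexEnvelope E t :=
  le_csSup ⟨E t, by rintro r ⟨ψ, _, hψ, rfl⟩; exact hψ t ht⟩ ⟨φ, hφ, hle, rfl⟩

/-- The lines of slope `-K` and `K` through the two end points of the graph of `E`. They show that
convex minorants exist, that the envelope touches `E` at `0` and `1`, and that its slopes there are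
bounded. -/
lemma exists_affine_minorants (hK : ∀ s ∈ Icc (0 : ℝ) 1, ∀ t ∈ Icc (0 : ℝ) 1,
    |E t - E s| ≤ K * |t - s|) :
    (∀ s ∈ Icc (0 : ℝ) 1, E 0 + -K * s ≤ E s) ∧
      ∀ s ∈ Icc (0 : ℝ) 1, (E 1 - K) + K * s ≤ E s := by
  constructor
  · intro s hs
    have := (abs_le.1 (hK 0 (by simp) s hs)).1
    rw [sub_zero, abs_of_nonneg hs.1] at this
    linarith
  · intro s hs
    have := (abs_le.1 (hK s hs 1 (by simp))).2
    rw [abs_of_nonneg (by linarith [hs.2])] at this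
    linarith

lemma envelopeSet_nonempty (hK : ∀ s ∈ Icc (0 : ℝ) 1, ∀ t ∈ Icc (0 : ℝ) 1,
    |E t - E s| ≤ K * |t - s|) (t : ℝ) :
    {r | ∃ φ : ℝ → ℝ, ConvexOn ℝ (Icc 0 1) φ ∧ (∀ s ∈ Icc (0 : ℝ) 1, φ s ≤ E s) ∧
      r = φ t}.Nonempty :=
  ⟨_, _, convexOn_affine _ (convex_Icc 0 1) _ _, (exists_affine_minorants hK).1, rfl⟩

lemma convexEnvelope_le (hK : ∀ s ∈ Icc (0 : ℝ) 1, ∀ t ∈ Icc (0 : ℝ) 1,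
    |E t - E s| ≤ K * |t - s|) {t : ℝ} (ht : t ∈ Icc (0 : ℝ) 1) :
    convexEnvelope E t ≤ E t :=
  csSup_le (envelopeSet_nonempty hK t) (by rintro r ⟨ψ, _, hψ, rfl⟩; exact hψ t ht)

lemma convexOn_convexEnvelope (hK : ∀ s ∈ Icc (0 : ℝ) 1, ∀ t ∈ Icc (0 : ℝ) 1,
    |E t - E s| ≤ K * |t - s|) : ConvexOn ℝ (Icc 0 1) (convexEnvelope E) := by
  refine ⟨convex_Icc 0 1, fun x hx y hy a b ha hb hab => ?_⟩
  refine csSup_le (envelopeSet_nonempty hK _) ?_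
  rintro r ⟨φ, hφ, hle, rfl⟩
  refine (hφ.2 hx hy ha hb hab).trans ?_
  exact add_le_add (mul_le_mul_of_nonneg_left (le_convexEnvelope hφ hle hx) ha)
    (mul_le_mul_of_nonneg_left (le_convexEnvelope hφ hle hy) hb)

lemma convexEnvelope_zero (hK : ∀ s ∈ Icc (0 : ℝ) 1, ∀ t ∈ Icc (0 : ℝ) 1,
    |E t - E s| ≤ K * |t - s|) : convexEnvelope E 0 = E 0 := by
  refine le_antisymm (convexEnvelope_le hK (by simp)) ?_
  have := le_convexEnvelope (convexOn_affine _ (convex_Icc 0 1) _ _)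
    (exists_affine_minorants hK).1 (t := 0) (by simp)
  simpa using this

lemma convexEnvelope_one (hK : ∀ s ∈ Icc (0 : ℝ) 1, ∀ t ∈ Icc (0 : ℝ) 1,
    |E t - E s| ≤ K * |t - s|) : convexEnvelope E 1 = E 1 := by
  refine le_antisymm (convexEnvelope_le hK (by simp)) ?_
  have := le_convexEnvelope (convexOn_affine _ (convex_Icc 0 1) _ _)
    (exists_affine_minorants hK).2 (t := 1) (by simp)
  simpa using this

/-- Away from contact points the envelope is locally affine. -/
lemma convexEnvelope_eventually_affine (hK : ∀ s ∈ Icc (0 : ℝ) 1, ∀ t ∈ Icc (0 : ℝ) 1,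
    |E t - E s| ≤ K * |t - s|) (hE : ContinuousOn E (Icc 0 1)) {t : ℝ} (ht : t ∈ Ioo (0 : ℝ) 1)
    (hlt : convexEnvelope E t < E t) :
    ∃ A B : ℝ, ∀ᶠ s in nhds t, convexEnvelope E s = A + B * s := by
  have hconv := convexOn_convexEnvelope hK
  have hc1 : ContinuousAt (convexEnvelope E) t := by
    have := hconv.continuousOn_interior
    rw [interior_Icc] at this
    exact this.continuousAt (Ioo_mem_nhds ht.1 ht.2)
  have hc2 : ContinuousAt E t := hE.continuousAt (Icc_mem_nhds ht.1 ht.2)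
  -- The level `c` separates the envelope from `E` on a whole window `[p, r]` around `t`, so the
  -- chord of the envelope over the window stays below `E`.
  obtain ⟨c, hc, hc'⟩ := exists_between hlt
  obtain ⟨δ, hδ, hball⟩ := Metric.eventually_nhds_iff_ball.1
    ((hc1.eventually_lt_const hc).and ((hc2.eventually_const_lt hc').and
      (Ioo_mem_nhds ht.1 ht.2)))
  set p := t - δ / 2 with hp
  set r := t + δ / 2 with hr
  have hin : ∀ s ∈ Icc p r, convexEnvelope E s < c ∧ c < E s ∧ s ∈ Ioo (0 : ℝ) 1 := by
    intro s hs
    refine hball s ?_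
    rw [Metric.mem_ball, Real.dist_eq, abs_lt]
    constructor <;> linarith [hs.1, hs.2]
  have hpr : p < r := by linarith
  have hpI := hin p ⟨le_rfl, hpr.le⟩
  have hrI := hin r ⟨hpr.le, le_rfl⟩
  set f := convexEnvelope E with hf
  have hd : 0 < r - p := sub_pos.2 hpr
  set B := (f r - f p) / (r - p) with hB
  set A := f p - B * p with hA
  have hBmul : B * (r - p) = f r - f p := div_mul_cancel₀ _ hd.ne'
  have hline : ∀ s, (r - p) * (A + B * s) = (r - s) * f p + (s - p) * f r := by
    intro s
    rw [hA]
    linear_combination (s - p) * hBmul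
  -- The maximum of the envelope and its chord is still a convex minorant of `E`: outside the window
  -- the chord is below the envelope, inside it is below `c`. By maximality the envelope lies above
  -- the chord on the window, hence equals it.
  have hφ : ConvexOn ℝ (Icc 0 1) (f ⊔ fun s => A + B * s) :=
    hconv.sup (convexOn_affine _ (convex_Icc 0 1) A B)
  have hφE : ∀ s ∈ Icc (0 : ℝ) 1, (f ⊔ fun s => A + B * s) s ≤ E s := by
    intro s hs
    rw [Pi.sup_apply]
    refine sup_le (convexEnvelope_le hK hs) ?_
    rcases lt_or_ge s p with hsp | hsp
    · have h1 := hconv.secant_mono_aux1 hs (Ioo_subset_Icc_self hrI.2.2) hsp hpr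
      have h2 := hline s
      refine le_trans ?_ (convexEnvelope_le hK hs)
      refine le_of_mul_le_mul_left ?_ hd
      rw [h2]; linarith
    rcases lt_or_ge r s with hsr | hsr
    · have h1 := hconv.secant_mono_aux1 (Ioo_subset_Icc_self hpI.2.2) hs hpr hsr
      have h2 := hline s
      refine le_trans ?_ (convexEnvelope_le hK hs)
      refine le_of_mul_le_mul_left ?_ hd
      rw [h2]; linarith
    · have h3 := hin s ⟨hsp, hsr⟩
      refine le_trans ?_ h3.2.1.le
      refine le_of_mul_le_mul_left ?_ hd
      rw [hline s]
      have h4 := mul_le_mul_of_nonneg_left hpI.1.le (sub_nonneg.2 hsr)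
      have h5 := mul_le_mul_of_nonneg_left hrI.1.le (sub_nonneg.2 hsp)
      linarith
  refine ⟨A, B, ?_⟩
  filter_upwards [Ioo_mem_nhds (show p < t by linarith) (show t < r by linarith)] with s hs
  have hs' := hin s (Ioo_subset_Icc_self hs)
  apply le_antisymm
  · have h1 := hconv.secant_mono_aux1 (Ioo_subset_Icc_self hpI.2.2)
      (Ioo_subset_Icc_self hrI.2.2) hs.1 hs.2
    refine le_of_mul_le_mul_left ?_ hd
    rw [hline s]; linarith
  · have := le_convexEnvelope hφ hφE (Ioo_subset_Icc_self hs'.2.2)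
    rw [Pi.sup_apply] at this
    exact le_sup_right.trans this

/-- At an interior contact point the envelope inherits the derivative. -/
lemma convexEnvelope_hasDerivAt_of_contact (hK : ∀ s ∈ Icc (0 : ℝ) 1, ∀ t ∈ Icc (0 : ℝ) 1,
    |E t - E s| ≤ K * |t - s|) {t d : ℝ} (ht : t ∈ Ioo (0 : ℝ) 1) (hE : HasDerivAt E d t)
    (heq : convexEnvelope E t = E t) : HasDerivAt (convexEnvelope E) d t := by
  have hconv := convexOn_convexEnvelope hK
  have hti : t ∈ interior (Icc (0 : ℝ) 1) := by rwa [interior_Icc]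
  have htI := Ioo_subset_Icc_self ht
  set f := convexEnvelope E with hf
  have hlr := hconv.leftDeriv_le_rightDeriv_of_mem_interior hti
  -- Each subgradient `κ` of the envelope at a contact point supports `E` there too, so `E - κ * s`
  -- has a local minimum and `κ = d`.
  have key : ∀ κ, derivWithin f (Iio t) t ≤ κ → κ ≤ derivWithin f (Ioi t) t → κ = d := by
    intro κ h1 h2
    have hmin : IsLocalMin (fun s => E s - κ * s) t := by
      filter_upwards [Icc_mem_nhds ht.1 ht.2] with s hs
      have hsE : f s ≤ E s := convexEnvelope_le hK hs
      rcases lt_trichotomy s t with hst | rfl | hst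
      · have h3 := hconv.slope_le_leftDeriv_of_mem_interior hs hti hst
        rw [slope_def_field, div_le_iff₀ (sub_pos.2 hst)] at h3
        have := mul_le_mul_of_nonneg_right h1 (sub_pos.2 hst).le
        linarith
      · exact le_rfl
      · have h3 := hconv.rightDeriv_le_slope_of_mem_interior hti hs hst
        rw [slope_def_field, le_div_iff₀ (sub_pos.2 hst)] at h3
        have := mul_le_mul_of_nonneg_right h2 (sub_pos.2 hst).le
        linarith
    have := hmin.hasDerivAt_eq_zero (hE.sub ((hasDerivAt_id t).const_mul κ))
    linarith
  have hl := hconv.hasDerivWithinAt_leftDeriv_of_mem_interior hti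
  have hr := hconv.hasDerivWithinAt_rightDeriv_of_mem_interior hti
  rw [key _ le_rfl hlr] at hl
  rw [key _ hlr le_rfl] at hr
  have := (hasDerivWithinAt_Iio_iff_Iic.1 hl).union (hasDerivWithinAt_Ioi_iff_Ici.1 hr)
  rwa [Iic_union_Ici, hasDerivWithinAt_univ] at this

/-- An interior point is either a contact point, where the derivative is inherited from `E`, or has
a neighbourhood where the envelope is affine. At `0` and `1` the slopes from the end point are
monotone, and the affine minorants bound them, so they converge. -/
lemma differentiableOn_convexEnvelope {e : ℝ → ℝ} (he : ContinuousOn e (Icc 0 1))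
    (hE : ∀ t ∈ Icc (0 : ℝ) 1, HasDerivWithinAt E (e t) (Icc 0 1) t) :
    DifferentiableOn ℝ (convexEnvelope E) (Icc 0 1) := by
  obtain ⟨K, _, hK⟩ := exists_abs_sub_le he hE
  have hconv := convexOn_convexEnvelope hK
  have hm := exists_affine_minorants hK
  intro t ht
  rcases eq_or_lt_of_le ht.1 with rfl | h0
  · have hmono : MonotoneOn (slope (convexEnvelope E) 0) (Ioo 0 1) :=
      (hconv.monotoneOn_slope_gt ht).mono fun s hs => ⟨Ioo_subset_Icc_self hs, hs.1⟩
    have hbd : BddBelow (slope (convexEnvelope E) 0 '' Ioo 0 1) := by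
      refine ⟨-K, ?_⟩
      rintro _ ⟨s, hs, rfl⟩
      rw [slope_def_field, le_div_iff₀ (sub_pos.2 hs.1), convexEnvelope_zero hK]
      have := le_convexEnvelope (convexOn_affine _ (convex_Icc 0 1) _ _) hm.1
        (Ioo_subset_Icc_self hs)
      linarith
    have hlim := hmono.tendsto_nhdsWithin_Ioo_right (by simp) hbd
    have h1 : HasDerivWithinAt (convexEnvelope E) _ (Ioi 0) 0 :=
      (hasDerivWithinAt_iff_tendsto_slope' (by simp)).2 hlim
    exact ((hasDerivWithinAt_Ioi_iff_Ici.1 h1).mono Icc_subset_Ici_self).differentiableWithinAt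
  rcases eq_or_lt_of_le ht.2 with rfl | h1
  · have hmono : MonotoneOn (slope (convexEnvelope E) 1) (Ioo 0 1) :=
      (hconv.monotoneOn_slope_lt ht).mono fun s hs => ⟨Ioo_subset_Icc_self hs, hs.2⟩
    have hbd : BddAbove (slope (convexEnvelope E) 1 '' Ioo 0 1) := by
      refine ⟨K, ?_⟩
      rintro _ ⟨s, hs, rfl⟩
      rw [slope_comm, slope_def_field, div_le_iff₀ (sub_pos.2 hs.2), convexEnvelope_one hK]
      have := le_convexEnvelope (convexOn_affine _ (convex_Icc 0 1) _ _) hm.2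
        (Ioo_subset_Icc_self hs)
      linarith
    have hlim := hmono.tendsto_nhdsWithin_Ioo_left (by simp) hbd
    have h1 : HasDerivWithinAt (convexEnvelope E) _ (Iio 1) 1 :=
      (hasDerivWithinAt_iff_tendsto_slope' (by simp)).2 hlim
    exact ((hasDerivWithinAt_Iio_iff_Iic.1 h1).mono Icc_subset_Iic_self).differentiableWithinAt
  · have hEt : HasDerivAt E (e t) t := (hE t ht).hasDerivAt (Icc_mem_nhds h0 h1)
    rcases (convexEnvelope_le hK ht).eq_or_lt with heq | hlt
    · exact (convexEnvelope_hasDerivAt_of_contact hK ⟨h0, h1⟩ hEt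
        heq).differentiableAt.differentiableWithinAt
    · obtain ⟨A, B, hAB⟩ := convexEnvelope_eventually_affine hK
        (fun s hs => (hE s hs).continuousWithinAt) ⟨h0, h1⟩ hlt
      have : HasDerivAt (fun s => A + B * s) (B * 1) t :=
        ((hasDerivAt_id t).const_mul B).const_add A
      exact (this.congr_of_eventuallyEq hAB).differentiableAt.differentiableWithinAt

/-- The derivative of the envelope. -/
abbrev envelopeDeriv (E : ℝ → ℝ) : ℝ → ℝ := derivWithin (convexEnvelope E) (Icc 0 1)

variable {e : ℝ → ℝ}

lemma envelopeDeriv_monotoneOn (he : ContinuousOn e (Icc 0 1))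
    (hE : ∀ t ∈ Icc (0 : ℝ) 1, HasDerivWithinAt E (e t) (Icc 0 1) t) :
    MonotoneOn (envelopeDeriv E) (Icc 0 1) := by
  obtain ⟨K, _, hK⟩ := exists_abs_sub_le he hE
  exact (convexOn_convexEnvelope hK).monotoneOn_derivWithin (differentiableOn_convexEnvelope he hE)

/-- By Darboux a derivative maps intervals to intervals, and a monotone function with that property
cannot jump. -/
lemma envelopeDeriv_continuousOn (he : ContinuousOn e (Icc 0 1))
    (hE : ∀ t ∈ Icc (0 : ℝ) 1, HasDerivWithinAt E (e t) (Icc 0 1) t) :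
    ContinuousOn (envelopeDeriv E) (Icc 0 1) :=
  (envelopeDeriv_monotoneOn he hE).continuousOn_of_ordConnected_image
    (ordConnected_Icc.image_derivWithin (differentiableOn_convexEnvelope he hE))

lemma envelopeDeriv_eq_of_contact (he : ContinuousOn e (Icc 0 1))
    (hE : ∀ t ∈ Icc (0 : ℝ) 1, HasDerivWithinAt E (e t) (Icc 0 1) t) {t : ℝ}
    (ht : t ∈ Ioo (0 : ℝ) 1) (heq : convexEnvelope E t = E t) : envelopeDeriv E t = e t := by
  obtain ⟨K, _, hK⟩ := exists_abs_sub_le he hE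
  have h1 := convexEnvelope_hasDerivAt_of_contact hK ht
    ((hE t (Ioo_subset_Icc_self ht)).hasDerivAt (Icc_mem_nhds ht.1 ht.2)) heq
  exact h1.hasDerivWithinAt.derivWithin (uniqueDiffOn_Icc_zero_one t (Ioo_subset_Icc_self ht))

lemma envelopeDeriv_eventually_const (he : ContinuousOn e (Icc 0 1))
    (hE : ∀ t ∈ Icc (0 : ℝ) 1, HasDerivWithinAt E (e t) (Icc 0 1) t) {t : ℝ}
    (ht : t ∈ Ioo (0 : ℝ) 1) (hlt : convexEnvelope E t < E t) :
    ∀ᶠ s in nhds t, envelopeDeriv E s = envelopeDeriv E t := by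
  obtain ⟨K, _, hK⟩ := exists_abs_sub_le he hE
  obtain ⟨A, B, hAB⟩ := convexEnvelope_eventually_affine hK
    (fun s hs => (hE s hs).continuousWithinAt) ht hlt
  have key : ∀ᶠ s in nhds t, envelopeDeriv E s = B := by
    filter_upwards [hAB.eventually_nhds, Ioo_mem_nhds ht.1 ht.2] with s hs hsI
    have : HasDerivAt (fun s => A + B * s) (B * 1) s :=
      ((hasDerivAt_id s).const_mul B).const_add A
    have h2 := (this.congr_of_eventuallyEq hs).hasDerivWithinAt.derivWithin
      (uniqueDiffOn_Icc_zero_one s (Ioo_subset_Icc_self hsI))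
    rw [mul_one] at h2
    exact h2
  filter_upwards [key] with s hs
  rw [hs, key.self_of_nhds]

/-- The derivative of the envelope is constant on intervals without contact points. -/
lemma envelopeDeriv_eq_of_no_contact (he : ContinuousOn e (Icc 0 1))
    (hE : ∀ t ∈ Icc (0 : ℝ) 1, HasDerivWithinAt E (e t) (Icc 0 1) t) {s t : ℝ}
    (hs : s ∈ Icc (0 : ℝ) 1) (ht : t ∈ Icc (0 : ℝ) 1) (hst : s ≤ t)
    (hno : ∀ k ∈ Ioo s t, convexEnvelope E k ≠ E k) : envelopeDeriv E s = envelopeDeriv E t := by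
  obtain ⟨K, _, hK⟩ := exists_abs_sub_le he hE
  rcases hst.eq_or_lt with rfl | hst
  · rfl
  have hd : ∀ k ∈ Ioo s t, HasDerivAt (envelopeDeriv E) 0 k := by
    intro k hk
    have hkI : k ∈ Ioo (0 : ℝ) 1 := ⟨hs.1.trans_lt hk.1, hk.2.trans_le ht.2⟩
    have hlt := lt_of_le_of_ne (convexEnvelope_le hK (Ioo_subset_Icc_self hkI)) (hno k hk)
    exact (hasDerivAt_const k _).congr_of_eventuallyEq
      (envelopeDeriv_eventually_const he hE hkI hlt)
  obtain ⟨k, hk, hk'⟩ := exists_hasDerivAt_eq_slope (envelopeDeriv E) (fun _ => 0) hst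
    ((envelopeDeriv_continuousOn he hE).mono (Icc_subset_Icc hs.1 ht.2)) hd
  have := (div_eq_zero_iff.1 hk'.symm).resolve_right (sub_pos.2 hst).ne'
  linarith

lemma integral_envelopeDeriv (he : ContinuousOn e (Icc 0 1))
    (hE : ∀ t ∈ Icc (0 : ℝ) 1, HasDerivWithinAt E (e t) (Icc 0 1) t) (h0 : E 0 = 0) {t : ℝ}
    (ht : t ∈ Icc (0 : ℝ) 1) : ∫ s in (0 : ℝ)..t, envelopeDeriv E s = convexEnvelope E t := by
  obtain ⟨K, _, hK⟩ := exists_abs_sub_le he hE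
  have hsub : Icc 0 t ⊆ Icc (0 : ℝ) 1 := Icc_subset_Icc_right ht.2
  have hdiff := differentiableOn_convexEnvelope he hE
  rw [intervalIntegral.integral_eq_sub_of_hasDerivAt_of_le ht.1 (hdiff.continuousOn.mono hsub)
    (fun s hs => (hdiff s (hsub (Ioo_subset_Icc_self hs))).hasDerivWithinAt.hasDerivAt
      (Icc_mem_nhds hs.1 (hs.2.trans_le ht.2)))
    (((envelopeDeriv_continuousOn he hE).mono (by rw [uIcc_of_le ht.1]; exact hsub)
      ).intervalIntegrable), convexEnvelope_zero hK, h0, sub_zero]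

/-- The derivative is constant before the first and after the last point of `[s, t]` at which it
equals `e = φ - ψ`. Its total increment is therefore an increment of `φ` inside `[s, t]` minus an
increment of `ψ`. -/
lemma envelopeDeriv_sub_lt (he : ContinuousOn e (Icc 0 1))
    (hE : ∀ t ∈ Icc (0 : ℝ) 1, HasDerivWithinAt E (e t) (Icc 0 1) t) {φ ψ : ℝ → ℝ}
    (hφ : StrictMonoOn φ (Icc 0 1)) (hψ : StrictMonoOn ψ (Icc 0 1))
    (heq : ∀ t ∈ Icc (0 : ℝ) 1, e t = φ t - ψ t) {s t : ℝ} (hs : s ∈ Icc (0 : ℝ) 1)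
    (ht : t ∈ Icc (0 : ℝ) 1) (hst : s < t) :
    envelopeDeriv E t - envelopeDeriv E s < φ t - φ s := by
  have hφst := hφ hs ht hst
  have hsub : Icc s t ⊆ Icc (0 : ℝ) 1 := Icc_subset_Icc hs.1 ht.2
  -- Equality of derivatives is used instead of contact, because contact at `0` or `1` does not
  -- force the derivatives to agree.
  set C : Set ℝ := {k ∈ Icc s t | envelopeDeriv E k - e k = 0} with hC
  have hclosed : IsClosed C :=
    (((envelopeDeriv_continuousOn he hE).sub he).mono hsub).preimage_isClosed_of_isClosed
      isClosed_Icc isClosed_singleton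
  have hcompact : IsCompact C := isCompact_Icc.of_isClosed_subset hclosed fun k hk => hk.1
  have hno : ∀ k ∈ Icc s t, k ∉ C → k ∈ Ioo s t → convexEnvelope E k ≠ E k := by
    intro k hk hkC hk' hcon
    refine hkC ⟨hk, ?_⟩
    rw [envelopeDeriv_eq_of_contact he hE ⟨hs.1.trans_lt hk'.1, hk'.2.trans_le ht.2⟩ hcon, sub_self]
  rcases C.eq_empty_or_nonempty with hemp | hne
  · rw [envelopeDeriv_eq_of_no_contact he hE hs ht hst.le fun k hk =>
      hno k (Ioo_subset_Icc_self hk) (by simp [hemp]) hk]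
    linarith
  obtain ⟨k₁, hk₁, hmin⟩ := hcompact.exists_isLeast hne
  obtain ⟨k₂, hk₂, hmax⟩ := hcompact.exists_isGreatest hne
  have h1 : envelopeDeriv E s = envelopeDeriv E k₁ :=
    envelopeDeriv_eq_of_no_contact he hE hs (hsub hk₁.1) hk₁.1.1 fun k hk =>
      hno k ⟨hk.1.le, hk.2.le.trans hk₁.1.2⟩ (fun h => (hmin h).not_gt hk.2)
        ⟨hk.1, hk.2.trans_le hk₁.1.2⟩
  have h2 : envelopeDeriv E k₂ = envelopeDeriv E t :=
    envelopeDeriv_eq_of_no_contact he hE (hsub hk₂.1) ht hk₂.1.2 fun k hk =>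
      hno k ⟨hk₂.1.1.trans hk.1.le, hk.2.le⟩ (fun h => (hmax h).not_gt hk.1)
        ⟨hk₂.1.1.trans_lt hk.1, hk.2⟩
  rw [h1, ← h2, sub_eq_zero.1 hk₁.2, sub_eq_zero.1 hk₂.2, heq _ (hsub hk₁.1), heq _ (hsub hk₂.1)]
  have h3 := hφ.monotoneOn hs (hsub hk₁.1) hk₁.1.1
  have h4 := hφ.monotoneOn (hsub hk₂.1) ht hk₂.1.2
  -- If the two points coincide, the increment is zero and strictness comes from `φ`; otherwise it
  -- comes from `ψ`.
  rcases (hmin hk₂).eq_or_lt with h | h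
  · rw [h]; linarith
  · have := hψ (hsub hk₁.1) (hsub hk₂.1) h
    linarith

/-- A monotone density whose primitive lies below `E`, with equality at the right end point, and
which is constant off the contact points, is the derivative of the envelope. -/
lemma eqOn_envelopeDeriv (he : ContinuousOn e (Icc 0 1))
    (hE : ∀ t ∈ Icc (0 : ℝ) 1, HasDerivWithinAt E (e t) (Icc 0 1) t) (h0 : E 0 = 0) {m : ℝ → ℝ}
    (hm : MonotoneOn m (Icc 0 1)) (hmc : ContinuousOn m (Icc 0 1))
    (hle : ∀ t ∈ Icc (0 : ℝ) 1, ∫ s in (0 : ℝ)..t, m s ≤ E t)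
    (h1 : ∫ s in (0 : ℝ)..1, m s = E 1)
    (hconst : ∀ y ∈ Icc (0 : ℝ) 1, ∀ z ∈ Icc (0 : ℝ) 1, y < z →
      (∀ k ∈ Icc y z, ∫ s in (0 : ℝ)..k, m s < E k) → m y = m z) :
    EqOn m (envelopeDeriv E) (Icc 0 1) := by
  obtain ⟨K, _, hK⟩ := exists_abs_sub_le he hE
  have hdc := envelopeDeriv_continuousOn he hE
  set g : ℝ → ℝ := fun s => envelopeDeriv E s - m s with hg
  have hgc : ContinuousOn g (Icc 0 1) := hdc.sub hmc
  obtain ⟨C, hC⟩ := isCompact_Icc.exists_bound_of_continuousOn hgc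
  have hgi : IntegrableOn g (Icc 0 1) := hgc.integrableOn_Icc
  have hii : ∀ {f : ℝ → ℝ}, ContinuousOn f (Icc 0 1) → ∀ t ∈ Icc (0 : ℝ) 1,
      IntervalIntegrable f volume 0 t := fun hf t ht =>
    (hf.mono (by rw [uIcc_of_le ht.1]; exact Icc_subset_Icc_right ht.2)).intervalIntegrable
  have hprim : ∀ t ∈ Icc (0 : ℝ) 1, ∫ s in (0 : ℝ)..t, g s =
      convexEnvelope E t - ∫ s in (0 : ℝ)..t, m s := by
    intro t ht
    rw [hg, intervalIntegral.integral_sub (hii hdc t ht) (hii hmc t ht),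
      integral_envelopeDeriv he hE h0 ht]
  have hpos : ∀ t ∈ Icc (0 : ℝ) 1, 0 ≤ ∫ s in (0 : ℝ)..t, g s := by
    intro t ht
    rw [hprim t ht, sub_nonneg]
    exact le_convexEnvelope (convexOn_primitive_of_monotoneOn hm) hle ht
  have hend : ∫ s in (0 : ℝ)..1, g s = 0 := by
    rw [hprim 1 (by simp), h1, convexEnvelope_one hK, sub_self]
  -- The primitive of `g` is nonnegative because that of `m` is a convex minorant of `E`, and it
  -- vanishes at `1`. So `∫ ē g ≤ 0`, while `∫ m g = 0` by the equality case.
  have e1 := integral_monotoneOn_mul_le zero_le_one (envelopeDeriv_monotoneOn he hE) hgi hC hpos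
  have e2 := integral_monotoneOn_mul_eq zero_le_one hm hgi hC hpos (by
    intro y hy z hz hyz hne
    -- If the primitive of `g` has no zero on `[y, z]`, that of `m` is strictly below the envelope,
    -- hence below `E`, and `hconst` applies.
    by_contra! hcon
    refine hne (hconst y hy z hz hyz fun k hk => ?_)
    have hkI : k ∈ Icc (0 : ℝ) 1 := ⟨hy.1.trans hk.1, hk.2.trans hz.2⟩
    have := lt_of_le_of_ne (hpos k hkI) (hcon k hk).symm
    rw [hprim k hkI] at this
    linarith [convexEnvelope_le hK hkI])
  rw [hend, mul_zero] at e1 e2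
  have h01 : (1 : ℝ) ∈ Icc (0 : ℝ) 1 := by simp
  have hsq : ∫ s in (0 : ℝ)..1, g s * g s ≤ 0 := by
    have h3 : ∀ s, g s * g s = envelopeDeriv E s * g s - m s * g s := fun s => by
      simp only [hg]; ring
    simp only [h3]
    rw [intervalIntegral.integral_sub (hii (hdc.fun_mul hgc) 1 h01)
      (hii (hmc.fun_mul hgc) 1 h01), e2]
    linarith
  intro t ht
  by_contra hne
  have hgt : g t ≠ 0 := fun h => hne (sub_eq_zero.1 h).symm
  have : 0 < ∫ s in (0 : ℝ)..1, g s * g s :=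
    intervalIntegral.integral_pos zero_lt_one (hgc.mul hgc) (fun s _ => mul_self_nonneg _)
      ⟨t, ht, mul_self_pos.2 hgt⟩
  linarith

end Envelope
-- The ironed gap and the ironed matching
lemma primitive_hasDerivWithinAt {e : ℝ → ℝ} (he : ContinuousOn e (Icc 0 1)) {t : ℝ}
    (ht : t ∈ Icc (0 : ℝ) 1) :
    HasDerivWithinAt (fun t => ∫ s in (0 : ℝ)..t, e s) (e t) (Icc 0 1) t := by
  have : Fact (t ∈ Icc (0 : ℝ) 1) := ⟨ht⟩
  refine intervalIntegral.integral_hasDerivWithinAt_right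
    (he.mono (by rw [uIcc_of_le ht.1]; exact Icc_subset_Icc_right ht.2)).intervalIntegrable
    ?_ (he t ht)
  exact he.stronglyMeasurableAtFilter_nhdsWithin measurableSet_Icc t

lemma intervalIntegrable_of_continuousOn_unit {f : ℝ → ℝ} (hf : ContinuousOn f (Icc 0 1)) {t : ℝ}
    (ht : t ∈ Icc (0 : ℝ) 1) : IntervalIntegrable f volume 0 t :=
  (hf.mono (by rw [uIcc_of_le ht.1]; exact Icc_subset_Icc_right ht.2)).intervalIntegrable

lemma deriv_nonneg_of_min_left {g : ℝ → ℝ} {d : ℝ} (hd : HasDerivWithinAt g d (Icc 0 1) 0)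
    (hg : ∀ t ∈ Icc (0 : ℝ) 1, g 0 ≤ g t) : 0 ≤ d := by
  have h1 : HasDerivWithinAt g d (Ioo 0 1) 0 := hd.mono Ioo_subset_Icc_self
  rw [hasDerivWithinAt_iff_tendsto_slope' (by simp), nhdsWithin_Ioo_eq_nhdsGT zero_lt_one] at h1
  refine ge_of_tendsto h1 ?_
  filter_upwards [Ioo_mem_nhdsGT (zero_lt_one' ℝ)] with t ht
  rw [slope_def_field]
  exact div_nonneg (sub_nonneg.2 (hg t (Ioo_subset_Icc_self ht))) (by linarith [ht.1])

lemma deriv_nonpos_of_min_right {g : ℝ → ℝ} {d : ℝ} (hd : HasDerivWithinAt g d (Icc 0 1) 1)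
    (hg : ∀ t ∈ Icc (0 : ℝ) 1, g 1 ≤ g t) : d ≤ 0 := by
  have h1 : HasDerivWithinAt g d (Ioo 0 1) 1 := hd.mono Ioo_subset_Icc_self
  rw [hasDerivWithinAt_iff_tendsto_slope' (by simp), nhdsWithin_Ioo_eq_nhdsLT zero_lt_one] at h1
  refine le_of_tendsto h1 ?_
  filter_upwards [Ioo_mem_nhdsLT (zero_lt_one' ℝ)] with t ht
  rw [slope_def_field]
  exact div_nonpos_of_nonneg_of_nonpos (sub_nonneg.2 (hg t (Ioo_subset_Icc_self ht)))
    (by linarith [ht.2])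

variable {xl xu yl yu : ℝ}

lemma quantileDiff_continuousOn (hx : xl < xu) (hy : yl < yu) (F : TypeDist xl xu)
    (G : TypeDist yl yu) :
    ContinuousOn (fun s => F.quantile s - G.quantile s) (Icc 0 1) :=
  (F.quantile_continuousOn hx).sub (G.quantile_continuousOn hy)

lemma quantileGap_hasDerivWithinAt (hx : xl < xu) (hy : yl < yu) (F : TypeDist xl xu)
    (G : TypeDist yl yu) : ∀ t ∈ Icc (0 : ℝ) 1,
      HasDerivWithinAt (quantileGap F G) (F.quantile t - G.quantile t) (Icc 0 1) t :=
  fun _ ht => primitive_hasDerivWithinAt (quantileDiff_continuousOn hx hy F G) ht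

lemma quantileGap_zero (F : TypeDist xl xu) (G : TypeDist yl yu) : quantileGap F G 0 = 0 := by
  simp [quantileGap]

lemma ironedGap_continuousOn (hx : xl < xu) (hy : yl < yu) (F : TypeDist xl xu)
    (G : TypeDist yl yu) : ContinuousOn (ironedGap F G) (Icc 0 1) :=
  envelopeDeriv_continuousOn (quantileDiff_continuousOn hx hy F G)
    (quantileGap_hasDerivWithinAt hx hy F G)

lemma ironedGap_monotoneOn (hx : xl < xu) (hy : yl < yu) (F : TypeDist xl xu)
    (G : TypeDist yl yu) : MonotoneOn (ironedGap F G) (Icc 0 1) :=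
  envelopeDeriv_monotoneOn (quantileDiff_continuousOn hx hy F G)
    (quantileGap_hasDerivWithinAt hx hy F G)

lemma integral_ironedGap (hx : xl < xu) (hy : yl < yu) (F : TypeDist xl xu)
    (G : TypeDist yl yu) {t : ℝ} (ht : t ∈ Icc (0 : ℝ) 1) :
    ∫ s in (0 : ℝ)..t, ironedGap F G s = convexEnvelope (quantileGap F G) t :=
  integral_envelopeDeriv (quantileDiff_continuousOn hx hy F G)
    (quantileGap_hasDerivWithinAt hx hy F G) (quantileGap_zero F G) ht

lemma exists_quantileGap_lipschitz (hx : xl < xu) (hy : yl < yu) (F : TypeDist xl xu)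
    (G : TypeDist yl yu) : ∃ K, ∀ s ∈ Icc (0 : ℝ) 1, ∀ t ∈ Icc (0 : ℝ) 1,
      |quantileGap F G t - quantileGap F G s| ≤ K * |t - s| := by
  obtain ⟨K, _, hK⟩ := exists_abs_sub_le (quantileDiff_continuousOn hx hy F G)
    (quantileGap_hasDerivWithinAt hx hy F G)
  exact ⟨K, hK⟩

/-- `E` minus its envelope is nonnegative and vanishes at `0`, so its one-sided derivative there is
nonnegative. This keeps the ironed matching above `yl`; the mirror bound at `1` keeps it below `yu`.
-/
lemma ironedGap_zero_le (hx : xl < xu) (hy : yl < yu) (F : TypeDist xl xu)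
    (G : TypeDist yl yu) : ironedGap F G 0 ≤ xl - yl := by
  obtain ⟨K, hK⟩ := exists_quantileGap_lipschitz hx hy F G
  have h0 : (0 : ℝ) ∈ Icc (0 : ℝ) 1 := by simp
  have h1 := (quantileGap_hasDerivWithinAt hx hy F G 0 h0).sub
    (differentiableOn_convexEnvelope (quantileDiff_continuousOn hx hy F G)
    (quantileGap_hasDerivWithinAt hx hy F G) 0 h0).hasDerivWithinAt
  have := deriv_nonneg_of_min_left h1 (fun t ht => by
    simp only [Pi.sub_apply, convexEnvelope_zero hK, sub_self, sub_nonneg]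
    exact convexEnvelope_le hK ht)
  rw [F.quantile_zero hx, G.quantile_zero hy] at this
  exact sub_nonneg.1 this

lemma le_ironedGap_one (hx : xl < xu) (hy : yl < yu) (F : TypeDist xl xu)
    (G : TypeDist yl yu) : xu - yu ≤ ironedGap F G 1 := by
  obtain ⟨K, hK⟩ := exists_quantileGap_lipschitz hx hy F G
  have h0 : (1 : ℝ) ∈ Icc (0 : ℝ) 1 := by simp
  have h1 := (quantileGap_hasDerivWithinAt hx hy F G 1 h0).sub
    (differentiableOn_convexEnvelope (quantileDiff_continuousOn hx hy F G)
    (quantileGap_hasDerivWithinAt hx hy F G) 1 h0).hasDerivWithinAt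
  have := deriv_nonpos_of_min_right h1 (fun t ht => by
    simp only [Pi.sub_apply, convexEnvelope_one hK, sub_self, sub_nonneg]
    exact convexEnvelope_le hK ht)
  rw [F.quantile_one hx, G.quantile_one hy] at this
  exact sub_nonpos.1 this

/-- The matching obtained by ironing the gap between the quantile functions. -/
def ironedMatching (F : TypeDist xl xu) (G : TypeDist yl yu) (x : ℝ) : ℝ :=
  x - ironedGap F G (F.cdf x)

/-- The distribution function takes values in `[0, 1]` everywhere, so the formula makes sense on the
whole line, with slope one outside `[xl, xu]`. -/
lemma ironedMatching_continuous (hx : xl < xu) (hy : yl < yu) (F : TypeDist xl xu)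
    (G : TypeDist yl yu) : Continuous (ironedMatching F G) :=
  continuous_id.sub ((ironedGap_continuousOn hx hy F G).comp_continuous (F.cdf_continuous hx)
    (F.cdf_mem_Icc hx))

lemma ironedMatching_sub_le (hx : xl < xu) (hy : yl < yu) (F : TypeDist xl xu)
    (G : TypeDist yl yu) {x y : ℝ} (hxy : x ≤ y) :
    ironedMatching F G y - ironedMatching F G x ≤ y - x := by
  have := ironedGap_monotoneOn hx hy F G (F.cdf_mem_Icc hx x) (F.cdf_mem_Icc hx y)
    (F.cdf_monotone hxy)
  simp only [ironedMatching]
  linarith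

lemma ironedMatching_strictMono (hx : xl < xu) (hy : yl < yu) (F : TypeDist xl xu)
    (G : TypeDist yl yu) : StrictMono (ironedMatching F G) := by
  intro x y hxy
  simp only [ironedMatching]
  rcases (F.cdf_monotone hxy.le).eq_or_lt with h | h
  · rw [h]; linarith
  have h1 : ironedGap F G (F.cdf y) - ironedGap F G (F.cdf x) <
      F.quantile (F.cdf y) - F.quantile (F.cdf x) :=
    envelopeDeriv_sub_lt (quantileDiff_continuousOn hx hy F G)
      (quantileGap_hasDerivWithinAt hx hy F G) (F.quantile_strictMonoOn hx)
      (G.quantile_strictMonoOn hy) (fun _ _ => rfl) (F.cdf_mem_Icc hx x) (F.cdf_mem_Icc hx y) h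
  -- `F.quantile ∘ F.cdf` projects onto `[xl, xu]`. Since `cdf x < cdf y` forces `xl < y` and `x <
  -- xu`, the projection can only lower `y` and raise `x`.
  have hyl : xl < y := by
    by_contra hcon
    rw [F.cdf_of_le hx (not_lt.1 hcon)] at h
    exact h.not_ge (F.cdf_mem_Icc hx x).1
  have hxu : x < xu := by
    by_contra hcon
    rw [F.cdf_of_ge hx (not_lt.1 hcon)] at h
    exact h.not_ge (F.cdf_mem_Icc hx y).2
  have h2 : F.quantile (F.cdf y) ≤ y := by
    rcases le_total y xu with hyu | hyu
    · rw [F.quantile_cdf ⟨hyl.le, hyu⟩]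
    · rw [F.cdf_of_ge hx hyu, F.quantile_one hx]; exact hyu
  have h3 : x ≤ F.quantile (F.cdf x) := by
    rcases le_total x xl with hxl | hxl
    · rw [F.cdf_of_le hx hxl, F.quantile_zero hx]; exact hxl
    · rw [F.quantile_cdf ⟨hxl, hxu.le⟩]
  linarith

lemma ironedMatching_quantile (hx : xl < xu) (F : TypeDist xl xu) (G : TypeDist yl yu) {t : ℝ}
    (ht : t ∈ Icc (0 : ℝ) 1) :
    ironedMatching F G (F.quantile t) = F.quantile t - ironedGap F G t := by
  rw [ironedMatching, F.cdf_quantile hx ht]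

lemma setIntegral_pas (hx : xl < xu) (F : TypeDist xl xu) (G : TypeDist yl yu) {x : ℝ}
    (hxI : x ∈ Icc xl xu) :
    ∫ s in Icc xl x, pas F G s ∂F.measure = ∫ t in (0 : ℝ)..F.cdf x, G.quantile t := by
  rw [F.setIntegral_Icc_measure hx _ hxI]
  refine intervalIntegral.integral_congr fun t ht => ?_
  have hc := F.cdf_mem_Icc hx x
  rw [uIcc_of_le hc.1] at ht
  simp only [pas]
  rw [F.cdf_quantile hx ⟨ht.1, ht.2.trans hc.2⟩]

lemma quantileGap_eq (hx : xl < xu) (hy : yl < yu) (F : TypeDist xl xu) (G : TypeDist yl yu)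
    {t : ℝ} (ht : t ∈ Icc (0 : ℝ) 1) : quantileGap F G t =
      (∫ s in (0 : ℝ)..t, F.quantile s) - ∫ s in (0 : ℝ)..t, G.quantile s :=
  intervalIntegral.integral_sub
    (intervalIntegrable_of_continuousOn_unit (F.quantile_continuousOn hx) ht)
    (intervalIntegrable_of_continuousOn_unit (G.quantile_continuousOn hy) ht)

lemma comp_quantile_continuousOn (hx : xl < xu) (F : TypeDist xl xu) {T : ℝ → ℝ}
    (hT : ContinuousOn T (Icc xl xu)) : ContinuousOn (fun t => T (F.quantile t)) (Icc 0 1) :=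
  hT.comp (F.quantile_continuousOn hx) fun _ ht => F.quantile_mem hx ht

lemma integral_quantile_sub_comp (hx : xl < xu) (F : TypeDist xl xu) {T : ℝ → ℝ}
    (hT : ContinuousOn T (Icc xl xu)) {t : ℝ} (ht : t ∈ Icc (0 : ℝ) 1) :
    ∫ s in (0 : ℝ)..t, (F.quantile s - T (F.quantile s)) =
      (∫ s in (0 : ℝ)..t, F.quantile s) - ∫ s in (0 : ℝ)..t, T (F.quantile s) :=
  intervalIntegral.integral_sub
    (intervalIntegrable_of_continuousOn_unit (F.quantile_continuousOn hx) ht)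
    (intervalIntegrable_of_continuousOn_unit (comp_quantile_continuousOn hx F hT) ht)

lemma integral_ironedMatching_quantile (hx : xl < xu) (hy : yl < yu) (F : TypeDist xl xu)
    (G : TypeDist yl yu) {t : ℝ} (ht : t ∈ Icc (0 : ℝ) 1) :
    ∫ s in (0 : ℝ)..t, ironedMatching F G (F.quantile s) =
      (∫ s in (0 : ℝ)..t, F.quantile s) - convexEnvelope (quantileGap F G) t := by
  rw [← integral_ironedGap hx hy F G ht, ← intervalIntegral.integral_sub
    (intervalIntegrable_of_continuousOn_unit (F.quantile_continuousOn hx) ht)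
    (intervalIntegrable_of_continuousOn_unit (ironedGap_continuousOn hx hy F G) ht)]
  refine intervalIntegral.integral_congr fun s hs => ?_
  rw [uIcc_of_le ht.1] at hs
  exact ironedMatching_quantile hx F G ⟨hs.1, hs.2.trans ht.2⟩

/-- In quantile coordinates the slack in feasibility is the distance from the primitive of the gap
up to the obstacle `E`; compression means that the obstacle is not touched. -/
lemma mem_compressionSet_iff (hx : xl < xu) (hy : yl < yu) (F : TypeDist xl xu)
    (G : TypeDist yl yu) {T : ℝ → ℝ} (hT : ContinuousOn T (Icc xl xu)) {x : ℝ}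
    (hxI : x ∈ Icc xl xu) : x ∈ compressionSet F G T ↔
      ∫ s in (0 : ℝ)..F.cdf x, (F.quantile s - T (F.quantile s)) < quantileGap F G (F.cdf x) := by
  have hc := F.cdf_mem_Icc hx x
  rw [compressionSet, mem_ofPred_eq, setIntegral_pas hx F G hxI, F.setIntegral_Icc_measure hx _ hxI,
    integral_quantile_sub_comp hx F hT hc, quantileGap_eq hx hy F G hc]
  constructor
  · intro h; linarith [h.2]
  · intro h; exact ⟨hxI, by linarith⟩

lemma IsLipschitzMatching.continuousOn {F : TypeDist xl xu} {G : TypeDist yl yu} {T : ℝ → ℝ}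
    (h : IsLipschitzMatching F G T) : ContinuousOn T (Icc xl xu) := h.lipschitz.continuousOn

lemma IsLipschitzMatching.integral_le (hx : xl < xu) {F : TypeDist xl xu}
    {G : TypeDist yl yu} {T : ℝ → ℝ} (h : IsLipschitzMatching F G T) {t : ℝ}
    (ht : t ∈ Icc (0 : ℝ) 1) :
    ∫ s in (0 : ℝ)..t, G.quantile s ≤ ∫ s in (0 : ℝ)..t, T (F.quantile s) := by
  have hq := F.quantile_mem hx ht
  have := h.feasible_le _ hq
  rwa [setIntegral_pas hx F G hq, F.setIntegral_Icc_measure hx _ hq, F.cdf_quantile hx ht] at this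

lemma IsLipschitzMatching.integral_eq (hx : xl < xu) {F : TypeDist xl xu}
    {G : TypeDist yl yu} {T : ℝ → ℝ} (h : IsLipschitzMatching F G T) :
    ∫ s in (0 : ℝ)..1, T (F.quantile s) = ∫ s in (0 : ℝ)..1, G.quantile s := by
  have hq := right_mem_Icc.2 hx.le
  have := h.feasible_eq
  rwa [setIntegral_pas hx F G hq, F.setIntegral_Icc_measure hx _ hq, F.cdf_right hx] at this

/-- This is where the Lipschitz constant `1` enters: `T` never rises faster than the identity. -/
lemma IsLipschitzMatching.gap_monotoneOn (hx : xl < xu) {F : TypeDist xl xu}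
    {G : TypeDist yl yu} {T : ℝ → ℝ} (h : IsLipschitzMatching F G T) :
    MonotoneOn (fun s => F.quantile s - T (F.quantile s)) (Icc 0 1) := by
  intro s hs t ht hst
  have h1 := (F.quantile_strictMonoOn hx).monotoneOn hs ht hst
  have h2 := h.lipschitz.dist_le_mul _ (F.quantile_mem hx ht) _ (F.quantile_mem hx hs)
  rw [Real.dist_eq, Real.dist_eq, abs_of_nonneg (sub_nonneg.2 h1)] at h2
  have h3 := (abs_le.1 h2).2
  simp only [NNReal.coe_one, one_mul] at h3
  dsimp only
  linarith

lemma IsLipschitzMatching.gap_integral_le (hx : xl < xu) (hy : yl < yu) {F : TypeDist xl xu}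
    {G : TypeDist yl yu} {T : ℝ → ℝ} (h : IsLipschitzMatching F G T) {t : ℝ}
    (ht : t ∈ Icc (0 : ℝ) 1) :
    ∫ s in (0 : ℝ)..t, (F.quantile s - T (F.quantile s)) ≤ quantileGap F G t := by
  rw [integral_quantile_sub_comp hx F h.continuousOn ht, quantileGap_eq hx hy F G ht]
  linarith [h.integral_le hx ht]

lemma IsLipschitzMatching.gap_integral_le_envelope (hx : xl < xu) (hy : yl < yu)
    {F : TypeDist xl xu} {G : TypeDist yl yu} {T : ℝ → ℝ} (h : IsLipschitzMatching F G T) {t : ℝ}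
    (ht : t ∈ Icc (0 : ℝ) 1) :
    ∫ s in (0 : ℝ)..t, (F.quantile s - T (F.quantile s)) ≤
      convexEnvelope (quantileGap F G) t :=
  le_convexEnvelope (convexOn_primitive_of_monotoneOn (h.gap_monotoneOn hx))
    (fun _ hs => h.gap_integral_le hx hy hs) ht

lemma IsLipschitzMatching.congr {F : TypeDist xl xu} {G : TypeDist yl yu} {T T' : ℝ → ℝ}
    (h : IsLipschitzMatching F G T) (hTT' : EqOn T' T (Icc xl xu)) :
    IsLipschitzMatching F G T' := by
  have hint : ∀ x ∈ Icc xl xu,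
      ∫ s in Icc xl x, T' s ∂F.measure = ∫ s in Icc xl x, T s ∂F.measure := fun x hx =>
    setIntegral_congr_fun measurableSet_Icc (hTT'.mono (Icc_subset_Icc_right hx.2))
  refine ⟨h.mapsTo.congr hTT'.symm, h.monotoneOn.congr hTT'.symm, ?_, fun x hx => ?_, ?_⟩
  · intro x hx y hy
    rw [hTT' hx, hTT' hy]
    exact h.lipschitz hx hy
  · rw [hint x hx]; exact h.feasible_le x hx
  · rw [setIntegral_congr_fun measurableSet_Icc hTT']; exact h.feasible_eq

lemma compressionSet_congr {F : TypeDist xl xu} {G : TypeDist yl yu} {T T' : ℝ → ℝ}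
    (hTT' : EqOn T' T (Icc xl xu)) : compressionSet F G T' = compressionSet F G T := by
  ext x
  simp only [compressionSet, mem_ofPred_eq]
  refine and_congr_right fun hx => ?_
  rw [setIntegral_congr_fun measurableSet_Icc (hTT'.mono (Icc_subset_Icc_right hx.2))]

/-- The end-point bounds on `ē` give the range, monotonicity of `ē` gives the Lipschitz bound, and
feasibility is the inequality between the envelope and `E`, with equality at `1`. -/
lemma isLipschitzMatching_ironedMatching (hx : xl < xu) (hy : yl < yu) (F : TypeDist xl xu)
    (G : TypeDist yl yu) : IsLipschitzMatching F G (ironedMatching F G) := by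
  obtain ⟨K, hK⟩ := exists_quantileGap_lipschitz hx hy F G
  have hmono := (ironedMatching_strictMono hx hy F G).monotone
  refine ⟨fun x hxI => ⟨?_, ?_⟩, hmono.monotoneOn _, ?_, fun x hxI => ?_, ?_⟩
  · refine le_trans ?_ (hmono hxI.1)
    rw [ironedMatching, F.cdf_left hx]
    linarith [ironedGap_zero_le hx hy F G]
  · refine (hmono hxI.2).trans ?_
    rw [ironedMatching, F.cdf_right hx]
    linarith [le_ironedGap_one hx hy F G]
  · refine LipschitzOnWith.of_dist_le_mul fun x _ y _ => ?_
    rw [NNReal.coe_one, one_mul, Real.dist_eq, Real.dist_eq]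
    rcases le_total x y with h | h
    · rw [abs_sub_comm, abs_sub_comm x, abs_of_nonneg (sub_nonneg.2 (hmono h)),
        abs_of_nonneg (sub_nonneg.2 h)]
      exact ironedMatching_sub_le hx hy F G h
    · rw [abs_of_nonneg (sub_nonneg.2 (hmono h)), abs_of_nonneg (sub_nonneg.2 h)]
      exact ironedMatching_sub_le hx hy F G h
  · have hc := F.cdf_mem_Icc hx x
    rw [setIntegral_pas hx F G hxI, F.setIntegral_Icc_measure hx _ hxI,
      integral_ironedMatching_quantile hx hy F G hc]
    linarith [quantileGap_eq hx hy F G hc, convexEnvelope_le hK hc]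
  · have hI := right_mem_Icc.2 hx.le
    have h1 : (1 : ℝ) ∈ Icc (0 : ℝ) 1 := by simp
    rw [setIntegral_pas hx F G hI, F.setIntegral_Icc_measure hx _ hI, F.cdf_right hx,
      integral_ironedMatching_quantile hx hy F G h1]
    linarith [quantileGap_eq hx hy F G h1, convexEnvelope_one hK]

lemma cdf_mem_Ioo_of_envelope_lt (hx : xl < xu) (hy : yl < yu) (F : TypeDist xl xu)
    (G : TypeDist yl yu) {t : ℝ} (ht : t ∈ Icc (0 : ℝ) 1)
    (hlt : convexEnvelope (quantileGap F G) t < quantileGap F G t) : t ∈ Ioo (0 : ℝ) 1 := by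
  obtain ⟨K, hK⟩ := exists_quantileGap_lipschitz hx hy F G
  refine ⟨lt_of_le_of_ne ht.1 ?_, lt_of_le_of_ne ht.2 ?_⟩
  · rintro rfl; exact hlt.ne (convexEnvelope_zero hK)
  · rintro rfl; exact hlt.ne (convexEnvelope_one hK)

lemma gap_ironedMatching_integral (hx : xl < xu) (hy : yl < yu) (F : TypeDist xl xu)
    (G : TypeDist yl yu) {t : ℝ} (ht : t ∈ Icc (0 : ℝ) 1) :
    ∫ s in (0 : ℝ)..t, (F.quantile s - ironedMatching F G (F.quantile s)) =
      convexEnvelope (quantileGap F G) t := by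
  rw [integral_quantile_sub_comp hx F (ironedMatching_continuous hx hy F G).continuousOn ht,
    integral_ironedMatching_quantile hx hy F G ht]
  ring

/-- Compression happens exactly off the contact set, where `ē` is locally constant. That `x` is
interior is recorded so that the two-sided derivative passes to maps agreeing with the ironed
matching only on `[xl, xu]`. -/
lemma ironedMatching_hasDerivAt (hx : xl < xu) (hy : yl < yu) (F : TypeDist xl xu)
    (G : TypeDist yl yu) {x : ℝ} (hxC : x ∈ compressionSet F G (ironedMatching F G)) :
    HasDerivAt (ironedMatching F G) 1 x ∧ x ∈ Ioo xl xu := by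
  have hxI := hxC.1
  have hc := F.cdf_mem_Icc hx x
  rw [mem_compressionSet_iff hx hy F G (ironedMatching_continuous hx hy F G).continuousOn hxI,
    gap_ironedMatching_integral hx hy F G hc] at hxC
  have ht := cdf_mem_Ioo_of_envelope_lt hx hy F G hc hxC
  constructor
  · have h1 := (F.cdf_continuous hx).continuousAt (x := x) |>.eventually
      (envelopeDeriv_eventually_const (quantileDiff_continuousOn hx hy F G)
        (quantileGap_hasDerivWithinAt hx hy F G) ht hxC)
    refine ((hasDerivAt_id x).sub_const (ironedGap F G (F.cdf x))).congr_of_eventuallyEq ?_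
    filter_upwards [h1] with y hy'
    exact congrArg (fun r => y - r) hy'
  · refine ⟨lt_of_le_of_ne hxI.1 ?_, lt_of_le_of_ne hxI.2 ?_⟩
    · rintro rfl; exact ht.1.ne (F.cdf_left hx).symm
    · rintro rfl; exact ht.2.ne (F.cdf_right hx)

/-! ### Characterizations of the ironed matching -/

lemma eqOn_of_comp_quantile (hx : xl < xu) (F : TypeDist xl xu) {T T' : ℝ → ℝ}
    (h : ∀ t ∈ Icc (0 : ℝ) 1, T (F.quantile t) = T' (F.quantile t)) : EqOn T T' (Icc xl xu) := by
  intro x hxI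
  have := h _ (F.cdf_mem_Icc hx x)
  rwa [F.quantile_cdf hxI] at this

/-- The ironed matching is characterized by having slope one on its compression set. -/
lemma eqOn_ironedMatching_iff_hasDerivAt (hx : xl < xu) (hy : yl < yu) (F : TypeDist xl xu)
    (G : TypeDist yl yu) (T : ℝ → ℝ) : EqOn T (ironedMatching F G) (Icc xl xu) ↔
      IsLipschitzMatching F G T ∧ ∀ x ∈ compressionSet F G T, HasDerivAt T 1 x := by
  constructor
  · intro h
    refine ⟨(isLipschitzMatching_ironedMatching hx hy F G).congr h, fun x hxC => ?_⟩
    rw [compressionSet_congr h] at hxC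
    obtain ⟨h1, h2⟩ := ironedMatching_hasDerivAt hx hy F G hxC
    refine h1.congr_of_eventuallyEq ?_
    filter_upwards [Icc_mem_nhds h2.1 h2.2] with y hyI using h hyI
  · rintro ⟨hT, hder⟩
    have hcont := comp_quantile_continuousOn hx F hT.continuousOn
    have key : EqOn (fun s => F.quantile s - T (F.quantile s)) (ironedGap F G) (Icc 0 1) := by
      refine eqOn_envelopeDeriv (quantileDiff_continuousOn hx hy F G)
        (quantileGap_hasDerivWithinAt hx hy F G) (quantileGap_zero F G) (hT.gap_monotoneOn hx)
        ((F.quantile_continuousOn hx).sub hcont) (fun t ht => hT.gap_integral_le hx hy ht) ?_ ?_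
      · have h1 : (1 : ℝ) ∈ Icc (0 : ℝ) 1 := by simp
        rw [integral_quantile_sub_comp hx F hT.continuousOn h1, quantileGap_eq hx hy F G h1,
          hT.integral_eq hx]
      · intro y hy' z hz hyz hlt
        have hqy := F.quantile_mem hx hy'
        have hqz := F.quantile_mem hx hz
        have hq := F.quantile_strictMonoOn hx hy' hz hyz
        -- All points between the two quantiles are in the compression set, so `T` has mean slope
        -- one there and the gap does not change.
        obtain ⟨k, hk, hk'⟩ := exists_hasDerivAt_eq_slope T (fun _ => 1) hq
          (hT.continuousOn.mono (Icc_subset_Icc hqy.1 hqz.2)) (fun w hw => by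
            have hwI : w ∈ Icc xl xu := ⟨hqy.1.trans hw.1.le, hw.2.le.trans hqz.2⟩
            refine hder w ((mem_compressionSet_iff hx hy F G hT.continuousOn hwI).2 ?_)
            refine hlt _ ⟨?_, ?_⟩
            · have := F.cdf_monotone hw.1.le
              rwa [F.cdf_quantile hx hy'] at this
            · have := F.cdf_monotone hw.2.le
              rwa [F.cdf_quantile hx hz] at this)
        rw [eq_div_iff (sub_pos.2 hq).ne'] at hk'
        linarith
    refine eqOn_of_comp_quantile hx F fun t ht => ?_
    rw [ironedMatching_quantile hx F G ht, ← key ht]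
    ring

/-- The ironed matching is the most dispersed Lipschitz matching. -/
lemma eqOn_ironedMatching_iff_majorizes (hx : xl < xu) (hy : yl < yu) (F : TypeDist xl xu)
    (G : TypeDist yl yu) (T : ℝ → ℝ) : EqOn T (ironedMatching F G) (Icc xl xu) ↔
      IsLipschitzMatching F G T ∧ ∀ T' : ℝ → ℝ, IsLipschitzMatching F G T' →
        Majorizes 0 1 (T ∘ F.quantile) (T' ∘ F.quantile) := by
  have hI := isLipschitzMatching_ironedMatching hx hy F G
  have hcomp : ∀ T' : ℝ → ℝ, IsLipschitzMatching F G T' → ∀ t ∈ Icc (0 : ℝ) 1,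
      ∫ s in (0 : ℝ)..t, ironedMatching F G (F.quantile s) ≤
        ∫ s in (0 : ℝ)..t, T' (F.quantile s) := by
    intro T' hT' t ht
    have := hT'.gap_integral_le_envelope hx hy ht
    rw [integral_quantile_sub_comp hx F hT'.continuousOn ht] at this
    rw [integral_ironedMatching_quantile hx hy F G ht]
    linarith
  constructor
  · intro h
    have hT := hI.congr h
    refine ⟨hT, fun T' hT' => ⟨fun t ht => ?_, ?_⟩⟩
    · refine le_of_eq_of_le ?_ (hcomp T' hT' t ht)
      refine intervalIntegral.integral_congr fun s hs => ?_
      rw [uIcc_of_le ht.1] at hs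
      exact h (F.quantile_mem hx ⟨hs.1, hs.2.trans ht.2⟩)
    · exact (hT.integral_eq hx).trans (hT'.integral_eq hx).symm
  · rintro ⟨hT, hmaj⟩
    -- Each map is at least as dispersed as the other, so the primitives coincide; their integrands
    -- are continuous and can be recovered by differentiation.
    have heq : EqOn (fun t => ∫ s in (0 : ℝ)..t, T (F.quantile s))
        (fun t => ∫ s in (0 : ℝ)..t, ironedMatching F G (F.quantile s)) (Icc 0 1) :=
      fun t ht => le_antisymm ((hmaj _ hI).1 t ht) (hcomp T hT t ht)
    refine eqOn_of_comp_quantile hx F fun t ht => ?_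
    have h1 := primitive_hasDerivWithinAt (comp_quantile_continuousOn hx F hT.continuousOn) ht
    have h2 := primitive_hasDerivWithinAt (comp_quantile_continuousOn hx F hI.continuousOn) ht
    exact (uniqueDiffOn_Icc_zero_one t ht).eq_deriv _ h1 (h2.congr heq (heq ht))

/-! ### Expectations through distribution functions, and the convex order -/

section Fubini

variable {μ ν : Measure ℝ} {l u K : ℝ} {m : ℝ → ℝ}

lemma intervalIntegrable_of_bounded (hm : Measurable m) (hK : ∀ x, |m x| ≤ K) (a b : ℝ) :
    IntervalIntegrable m volume a b := by
  rw [intervalIntegrable_iff, uIoc]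
  exact Integrable.of_bound hm.aestronglyMeasurable K (Filter.Eventually.of_forall hK)

/-- Fubini on the region `z ≤ s`. -/
lemma integral_tail_eq [IsFiniteMeasure μ] (hlu : l ≤ u) (hμ : μ (Icc l u)ᶜ = 0) (hm : Measurable m)
    (hK : ∀ x, |m x| ≤ K) :
    ∫ z, (∫ s in z..u, m s) ∂μ = ∫ s in l..u, m s * μ.real (Iic s) := by
  have hae : ∀ᵐ z ∂μ, z ∈ Icc l u :=
    (measure_eq_zero_iff_ae_notMem.1 hμ).mono fun _ hx => by simpa using hx
  have h1 : ∫ z, (∫ s in z..u, m s) ∂μ =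
      ∫ z, (∫ s in Icc l u, (Ici z).indicator m s) ∂μ := by
    refine integral_congr_ae (hae.mono fun z hz => ?_)
    dsimp only
    rw [setIntegral_indicator measurableSet_Ici, intervalIntegral.integral_of_le hz.2,
      ← integral_Icc_eq_integral_Ioc]
    congr 2
    ext s
    exact ⟨fun h => ⟨⟨hz.1.trans h.1, h.2⟩, h.1⟩, fun h => ⟨h.2, h.1.2⟩⟩
  have hmeas : MeasurableSet {w : ℝ × ℝ | w.1 ≤ w.2} := measurableSet_le measurable_fst measurable_snd
  have h2 : Integrable (Function.uncurry fun z s => (Ici z).indicator m s)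
      (μ.prod (volume.restrict (Icc l u))) := by
    have heq : (Function.uncurry fun z s => (Ici z).indicator m s) =
        {w : ℝ × ℝ | w.1 ≤ w.2}.indicator fun w => m w.2 := by
      ext w
      simp only [Function.uncurry, indicator, mem_Ici, mem_ofPred_eq]
    rw [heq]
    refine Integrable.of_bound
      ((hm.comp measurable_snd).indicator hmeas).aestronglyMeasurable K
      (Filter.Eventually.of_forall fun w => ?_)
    exact (norm_indicator_le_norm_self _ _).trans (hK w.2)
  rw [h1, integral_integral_swap h2, intervalIntegral.integral_of_le hlu,
    ← integral_Icc_eq_integral_Ioc]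
  refine integral_congr_ae (Filter.Eventually.of_forall fun s => ?_)
  dsimp only
  have h3 : ∀ z, (Ici z).indicator m s = (Iic s).indicator (fun _ => m s) z := fun z => by
    simp only [indicator, mem_Ici, mem_Iic]
  simp only [h3]
  rw [integral_indicator measurableSet_Iic, setIntegral_const, smul_eq_mul, mul_comm]

/-- The tail identity for the indicator of `(-∞, y]`, whose integral from `z` to `u` is the
shortfall of `z` below `y`. Majorization thus becomes a comparison of expected shortfalls. -/
lemma integral_max_eq [IsFiniteMeasure μ] (hμ : μ (Icc l u)ᶜ = 0) {y : ℝ} (hy : y ∈ Icc l u) :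
    ∫ z, max (y - z) 0 ∂μ = ∫ s in l..y, μ.real (Iic s) := by
  have hlu : l ≤ u := hy.1.trans hy.2
  have hae : ∀ᵐ z ∂μ, z ∈ Icc l u :=
    (measure_eq_zero_iff_ae_notMem.1 hμ).mono fun _ hx => by simpa using hx
  have h1 := integral_tail_eq (m := (Iic y).indicator fun _ => (1 : ℝ)) (K := 1) hlu hμ
    (measurable_const.indicator measurableSet_Iic) (fun x => by
      by_cases h : x ∈ Iic y <;> simp [h])
  have h2 : ∫ z, max (y - z) 0 ∂μ =
      ∫ z, (∫ s in z..u, (Iic y).indicator (fun _ => (1 : ℝ)) s) ∂μ := by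
    refine integral_congr_ae (hae.mono fun z hz => ?_)
    dsimp only
    rw [intervalIntegral.integral_of_le hz.2, setIntegral_indicator measurableSet_Iic,
      Ioc_inter_Iic, min_eq_right hy.2]
    simp
  rw [h2, h1, intervalIntegral.integral_of_le hlu, intervalIntegral.integral_of_le hy.1]
  have h3 : ∀ s, (Iic y).indicator (fun _ => (1 : ℝ)) s * μ.real (Iic s) =
      (Iic y).indicator (fun s => μ.real (Iic s)) s := fun s => by
    by_cases h : s ∈ Iic y <;> simp [h]
  simp only [h3]
  rw [setIntegral_indicator measurableSet_Iic, Ioc_inter_Iic, min_eq_right hy.2]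

lemma measureReal_Iic_monotone [IsFiniteMeasure μ] : Monotone fun s => μ.real (Iic s) :=
  fun _ _ h => measureReal_mono (Iic_subset_Iic.2 h)

lemma integrable_tail [IsFiniteMeasure μ] (hμ : μ (Icc l u)ᶜ = 0)
    (hm : Measurable m) (hK : ∀ x, |m x| ≤ K) (c : ℝ) :
    Integrable (fun z => ∫ s in c..z, m s) μ := by
  have hc : Continuous fun z => ∫ s in c..z, m s :=
    intervalIntegral.continuous_primitive (intervalIntegrable_of_bounded hm hK) c
  have hae : ∀ᵐ z ∂μ, z ∈ Icc l u :=
    (measure_eq_zero_iff_ae_notMem.1 hμ).mono fun _ hx => by simpa using hx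
  rw [← Measure.restrict_eq_self_of_ae_mem hae]
  exact hc.continuousOn.integrableOn_compact isCompact_Icc

/-- Difference of expectations of a primitive, in terms of distribution functions. -/
lemma integral_primitive_sub [IsProbabilityMeasure μ] [IsProbabilityMeasure ν] (hlu : l ≤ u)
    (hμ : μ (Icc l u)ᶜ = 0) (hν : ν (Icc l u)ᶜ = 0) (hm : Measurable m) (hK : ∀ x, |m x| ≤ K) :
    (∫ z, (∫ s in l..z, m s) ∂ν) - ∫ z, (∫ s in l..z, m s) ∂μ =
      -∫ s in l..u, m s * (ν.real (Iic s) - μ.real (Iic s)) := by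
  have hii := intervalIntegrable_of_bounded hm hK
  have key : ∀ ρ : Measure ℝ, IsProbabilityMeasure ρ → ρ (Icc l u)ᶜ = 0 →
      ∫ z, (∫ s in l..z, m s) ∂ρ = (∫ s in l..u, m s) - ∫ s in l..u, m s * ρ.real (Iic s) := by
    intro ρ _ hρ
    have h1 : ∀ z, ∫ s in l..z, m s = (∫ s in l..u, m s) - ∫ s in z..u, m s := fun z => by
      rw [← intervalIntegral.integral_add_adjacent_intervals (hii l z) (hii z u)]; ring
    have h2 : Integrable (fun z => ∫ s in z..u, m s) ρ := by
      have := (integrable_tail hρ hm hK u).neg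
      refine this.congr (Filter.Eventually.of_forall fun z => ?_)
      simp only [Pi.neg_apply]
      exact (intervalIntegral.integral_symm _ _).symm
    rw [funext h1, integral_sub (integrable_const _) h2, integral_tail_eq hlu hρ hm hK]
    simp
  have hint : ∀ ρ : Measure ℝ, IsProbabilityMeasure ρ →
      IntervalIntegrable (fun s => m s * ρ.real (Iic s)) volume l u := by
    intro ρ _
    refine intervalIntegrable_of_bounded (K := K)
      (hm.mul measureReal_Iic_monotone.measurable) (fun x => ?_) l u
    change |m x * ρ.real (Iic x)| ≤ K
    rw [abs_mul, abs_of_nonneg measureReal_nonneg]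
    have h1 : ρ.real (Iic x) ≤ 1 := measureReal_le_one
    calc |m x| * ρ.real (Iic x) ≤ |m x| * 1 := mul_le_mul_of_nonneg_left h1 (abs_nonneg _)
      _ ≤ K := by rw [mul_one]; exact hK x
  have h3 : ∀ s, m s * (ν.real (Iic s) - μ.real (Iic s)) =
      m s * ν.real (Iic s) - m s * μ.real (Iic s) := fun s => by ring
  simp only [h3]
  rw [key ν ‹_› hν, key μ ‹_› hμ, intervalIntegral.integral_sub (hint ν ‹_›) (hint μ ‹_›)]
  ring

end Fubini

section ConvexOrder

variable {l u : ℝ} {G : TypeDist l u} {μ : Measure ℝ} {m : ℝ → ℝ} {K : ℝ}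

lemma majorizes_primitive [IsProbabilityMeasure μ]
    (hmaj : Majorizes l u (fun y => μ.real (Iic y)) G.cdf) :
    (∀ y ∈ Icc l u, ∫ s in l..y, (G.measure.real (Iic s) - μ.real (Iic s)) =
      (∫ s in l..y, G.cdf s) - ∫ s in l..y, μ.real (Iic s)) ∧
    (∀ y ∈ Icc l u, 0 ≤ ∫ s in l..y, (G.measure.real (Iic s) - μ.real (Iic s))) ∧
    ∫ s in l..u, (G.measure.real (Iic s) - μ.real (Iic s)) = 0 := by
  have h1 : ∀ y, ∫ s in l..y, (G.measure.real (Iic s) - μ.real (Iic s)) =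
      (∫ s in l..y, G.cdf s) - ∫ s in l..y, μ.real (Iic s) := fun y =>
    intervalIntegral.integral_sub measureReal_Iic_monotone.intervalIntegrable
      measureReal_Iic_monotone.intervalIntegrable
  refine ⟨fun y _ => h1 y, fun y hy => ?_, ?_⟩
  · rw [h1, sub_nonneg]; exact hmaj.1 y hy
  · rw [h1, sub_eq_zero]; exact hmaj.2.symm

lemma integrableOn_cdf_sub [IsProbabilityMeasure μ] :
    IntegrableOn (fun s => G.measure.real (Iic s) - μ.real (Iic s)) (Icc l u) :=
  ((measureReal_Iic_monotone.monotoneOn _).integrableOn_isCompact isCompact_Icc).sub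
    ((measureReal_Iic_monotone.monotoneOn _).integrableOn_isCompact isCompact_Icc)

lemma abs_cdf_sub_le [IsProbabilityMeasure μ] (hlu : l < u) (s : ℝ) :
    |G.measure.real (Iic s) - μ.real (Iic s)| ≤ 1 := by
  have := G.isProbabilityMeasure hlu
  have h1 : G.measure.real (Iic s) ≤ 1 := measureReal_le_one
  have h2 : μ.real (Iic s) ≤ 1 := measureReal_le_one
  have h3 : 0 ≤ G.measure.real (Iic s) := measureReal_nonneg
  have h4 : 0 ≤ μ.real (Iic s) := measureReal_nonneg
  rw [abs_le]
  constructor <;> linarith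

/-- Expectations of convex functions increase when passing to a majorized distribution. -/
lemma integral_primitive_le [IsProbabilityMeasure μ] (hlu : l < u) (hμ : μ (Icc l u)ᶜ = 0)
    (hmaj : Majorizes l u (fun y => μ.real (Iic y)) G.cdf) (hm : Monotone m)
    (hK : ∀ x, |m x| ≤ K) :
    ∫ z, (∫ s in l..z, m s) ∂μ ≤ ∫ z, (∫ s in l..z, m s) ∂G.measure := by
  have := G.isProbabilityMeasure hlu
  have h := majorizes_primitive hmaj
  have h1 := integral_primitive_sub hlu.le hμ G.measure_compl_Icc hm.measurable hK
  have h2 := integral_monotoneOn_mul_le hlu.le (hm.monotoneOn _) integrableOn_cdf_sub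
    (fun s _ => abs_cdf_sub_le hlu s) h.2.1
  rw [h.2.2, mul_zero] at h2
  linarith

/-- The equality case of the second mean value inequality with `g` the difference of the
distribution functions; it yields the wage equality in equilibrium. -/
lemma integral_primitive_eq [IsProbabilityMeasure μ] (hlu : l < u) (hμ : μ (Icc l u)ᶜ = 0)
    (hmaj : Majorizes l u (fun y => μ.real (Iic y)) G.cdf) (hm : Monotone m)
    (hK : ∀ x, |m x| ≤ K)
    (hzero : ∀ y ∈ Icc l u, ∀ z ∈ Icc l u, y < z → m y ≠ m z →
      ∃ k ∈ Icc y z, ∫ s in l..k, μ.real (Iic s) = ∫ s in l..k, G.cdf s) :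
    ∫ z, (∫ s in l..z, m s) ∂μ = ∫ z, (∫ s in l..z, m s) ∂G.measure := by
  have := G.isProbabilityMeasure hlu
  have h := majorizes_primitive hmaj
  have h1 := integral_primitive_sub hlu.le hμ G.measure_compl_Icc hm.measurable hK
  have h2 := integral_monotoneOn_mul_eq hlu.le (hm.monotoneOn _) integrableOn_cdf_sub
    (fun s _ => abs_cdf_sub_le hlu s) h.2.1 (by
      intro y hy z hz hyz hne
      obtain ⟨k, hk, hk'⟩ := hzero y hy z hz hyz hne
      exact ⟨k, hk, by rw [h.1 k ⟨hy.1.trans hk.1, hk.2.trans hz.2⟩, hk', sub_self]⟩)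
  rw [h.2.2, mul_zero] at h2
  linarith

/-- The convex order inequality for Lipschitz convex functions. -/
lemma integral_convexOn_le [IsProbabilityMeasure μ] (hlu : l < u) (hμ : μ (Icc l u)ᶜ = 0)
    (hmaj : Majorizes l u (fun y => μ.real (Iic y)) G.cdf) {q : ℝ → ℝ} {L : NNReal}
    (hq : ConvexOn ℝ (Icc l u) q) (hL : LipschitzOnWith L q (Icc l u)) :
    ∫ z, q z ∂μ ≤ ∫ z, q z ∂G.measure := by
  obtain ⟨m, hm, hK, hprim⟩ := exists_monotone_primitive_of_convexOn hlu hq hL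
  have hGp := G.isProbabilityMeasure hlu
  have key : ∀ ρ : Measure ℝ, IsProbabilityMeasure ρ → ρ (Icc l u)ᶜ = 0 →
      ∫ z, q z ∂ρ = q l + ∫ z, (∫ s in l..z, m s) ∂ρ := by
    intro ρ _ hρ
    have hae : ∀ᵐ z ∂ρ, z ∈ Icc l u :=
      (measure_eq_zero_iff_ae_notMem.1 hρ).mono fun _ hx => by simpa using hx
    have : ∫ z, q z ∂ρ = ∫ z, (q l + ∫ s in l..z, m s) ∂ρ :=
      integral_congr_ae (hae.mono fun z hz => by
        dsimp only
        rw [← hprim l (left_mem_Icc.2 hlu.le) z hz]; ring)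
    rw [this, integral_add (integrable_const _) (integrable_tail hρ hm.measurable hK l)]
    simp
  rw [key μ ‹_› hμ, key _ hGp G.measure_compl_Icc]
  linarith [integral_primitive_le hlu hμ hmaj hm hK]

end ConvexOrder

section Quantiles

/-- If the primitive of `R` dominates that of `Q`, with equality at the end, then `R` is less
dispersed than `Q`. -/
lemma integral_max_sub_le {R Q : ℝ → ℝ} (hR : MonotoneOn R (Icc 0 1))
    (hRc : ContinuousOn R (Icc 0 1)) (hQc : ContinuousOn Q (Icc 0 1))
    (hle : ∀ t ∈ Icc (0 : ℝ) 1, ∫ s in (0 : ℝ)..t, Q s ≤ ∫ s in (0 : ℝ)..t, R s)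
    (heq : ∫ s in (0 : ℝ)..1, R s = ∫ s in (0 : ℝ)..1, Q s) (y : ℝ) :
    ∫ t in (0 : ℝ)..1, max (y - R t) 0 ≤ ∫ t in (0 : ℝ)..1, max (y - Q t) 0 := by
  classical
  have h01 : (1 : ℝ) ∈ Icc (0 : ℝ) 1 := by simp
  -- A subgradient of `r ↦ max (y - r) 0` at `R t`; it increases in `t` because `R` does.
  set m : ℝ → ℝ := fun t => if R t < y then -1 else 0 with hm
  have hmono : MonotoneOn m (Icc 0 1) := by
    intro s hs t ht hst
    have := hR hs ht hst
    simp only [hm]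
    split_ifs <;> linarith
  have hgc : ContinuousOn (fun t => R t - Q t) (Icc 0 1) := hRc.sub hQc
  obtain ⟨C, hC⟩ := isCompact_Icc.exists_bound_of_continuousOn hgc
  have hprim : ∀ t ∈ Icc (0 : ℝ) 1, ∫ s in (0 : ℝ)..t, (R s - Q s) =
      (∫ s in (0 : ℝ)..t, R s) - ∫ s in (0 : ℝ)..t, Q s := fun t ht =>
    intervalIntegral.integral_sub (intervalIntegrable_of_continuousOn_unit hRc ht)
      (intervalIntegrable_of_continuousOn_unit hQc ht)
  have h1 := integral_monotoneOn_mul_le zero_le_one hmono hgc.integrableOn_Icc hC (fun t ht => by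
    rw [hprim t ht, sub_nonneg]; exact hle t ht)
  rw [hprim 1 h01, heq, sub_self, mul_zero] at h1
  have hi1 : IntervalIntegrable (fun t => m t * (R t - Q t)) volume 0 1 :=
    intervalIntegrable_monotoneOn_mul hmono hgc.integrableOn_Icc (by simp) h01
  have hi2 : IntervalIntegrable (fun t => max (y - R t) 0) volume 0 1 :=
    intervalIntegrable_of_continuousOn_unit
      (ContinuousOn.sup (continuousOn_const.sub hRc) continuousOn_const) h01
  have hi3 : IntervalIntegrable (fun t => max (y - Q t) 0) volume 0 1 :=
    intervalIntegrable_of_continuousOn_unit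
      (ContinuousOn.sup (continuousOn_const.sub hQc) continuousOn_const) h01
  have h2 := intervalIntegral.integral_mono_on zero_le_one (hi2.sub hi3) hi1 (fun t ht => by
    simp only [hm]
    split_ifs with h
    · rw [max_eq_left (by linarith)]
      linarith [le_max_left (y - Q t) 0]
    · rw [max_eq_right (by linarith)]
      linarith [le_max_right (y - Q t) 0])
  rw [intervalIntegral.integral_sub hi2 hi3] at h2
  linarith

/-- The threshold `R t` cuts a monotone `R` at `t`: the shortfall is `R t - R s` before `t` and zero
after. -/
lemma integral_max_sub_self {R : ℝ → ℝ} (hR : MonotoneOn R (Icc 0 1)) {t : ℝ}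
    (ht : t ∈ Icc (0 : ℝ) 1) :
    ∫ s in (0 : ℝ)..1, max (R t - R s) 0 = t * R t - ∫ s in (0 : ℝ)..t, R s := by
  have h0 : (0 : ℝ) ∈ Icc (0 : ℝ) 1 := by simp
  have h1 : (1 : ℝ) ∈ Icc (0 : ℝ) 1 := by simp
  have hanti : AntitoneOn (fun s => max (R t - R s) 0) (Icc 0 1) := by
    intro a ha b hb hab
    exact max_le_max_right _ (by linarith [hR ha hb hab])
  have hi : ∀ a ∈ Icc (0 : ℝ) 1, ∀ b ∈ Icc (0 : ℝ) 1,
      IntervalIntegrable (fun s => max (R t - R s) 0) volume a b := fun a ha b hb =>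
    (hanti.mono (uIcc_subset_Icc ha hb)).intervalIntegrable
  rw [← intervalIntegral.integral_add_adjacent_intervals (hi 0 h0 t ht) (hi t ht 1 h1)]
  have e1 : ∫ s in (0 : ℝ)..t, max (R t - R s) 0 = ∫ s in (0 : ℝ)..t, (R t - R s) := by
    refine intervalIntegral.integral_congr fun s hs => ?_
    rw [uIcc_of_le ht.1] at hs
    exact max_eq_left (sub_nonneg.2 (hR ⟨hs.1, hs.2.trans ht.2⟩ ht hs.2))
  have e2 : ∫ s in t..(1 : ℝ), max (R t - R s) 0 = ∫ s in t..(1 : ℝ), (0 : ℝ) := by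
    refine intervalIntegral.integral_congr fun s hs => ?_
    rw [uIcc_of_le ht.2] at hs
    exact max_eq_right (sub_nonpos.2 (hR ht ⟨ht.1.trans hs.1, hs.2⟩ hs.1))
  rw [e1, e2, intervalIntegral.integral_sub intervalIntegrable_const
    (intervalIntegrable_of_monotoneOn_Icc hR h0 ht)]
  simp

end Quantiles

/-! ### Existence: the assignment and prices of the ironed matching -/

/-- A function that is Lipschitz at small distances on an interval is Lipschitz there. -/
lemma abs_sub_le_of_local {f : ℝ → ℝ} {l u δ K : ℝ} (hδ : 0 < δ)
    (h : ∀ s ∈ Icc l u, ∀ t ∈ Icc l u, s ≤ t → t - s ≤ δ → |f t - f s| ≤ K * (t - s))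
    {s t : ℝ} (hs : s ∈ Icc l u) (ht : t ∈ Icc l u) (hst : s ≤ t) :
    |f t - f s| ≤ K * (t - s) := by
  have key : ∀ n : ℕ, ∀ t ∈ Icc l u, s ≤ t → t - s ≤ n * δ → |f t - f s| ≤ K * (t - s) := by
    intro n
    induction n with
    | zero =>
      intro t ht hst hn
      obtain rfl : t = s := le_antisymm (by simpa using hn) hst
      simp
    | succ n ih =>
      intro t ht hst hn
      push_cast at hn
      have hr : s ≤ max s (t - δ) := le_max_left _ _
      have hrt : max s (t - δ) ≤ t := max_le hst (by linarith)
      have hrI : max s (t - δ) ∈ Icc l u := ⟨hs.1.trans hr, hrt.trans ht.2⟩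
      have h1 := ih _ hrI hr (by
        have : (0 : ℝ) ≤ n * δ := by positivity
        rw [sub_le_iff_le_add]
        exact max_le (by linarith) (by linarith))
      have h2 := h _ hrI t ht hrt (by linarith [le_max_right s (t - δ)])
      have h3 := abs_sub_le (f t) (f (max s (t - δ))) (f s)
      linarith
  obtain ⟨n, hn⟩ := exists_nat_ge ((t - s) / δ)
  exact key n t ht hst ((div_le_iff₀ hδ).1 hn)

/-- The loss function is the primitive of a bounded antitone function. -/
lemma exists_antitone_primitive (hx : xl < xu) (hy : yl < yu) {v : ℝ → ℝ → ℝ} {a b : ℝ → ℝ} {c : ℝ}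
    (ha : ConcaveOn ℝ (Icc (yl - xu) (yu - xl)) a)
    (hv : ∀ x ∈ Icc xl xu, ∀ z ∈ Icc yl yu, v x z = a (z - x) + b x + c * z)
    (hvLip : ∃ K, LipschitzOnWith K (fun w : ℝ × ℝ => v w.1 w.2) (Icc xl xu ×ˢ Icc yl yu)) :
    ∃ (α : ℝ → ℝ) (K : ℝ), Antitone α ∧ (∀ d, |α d| ≤ K) ∧
      ∀ s ∈ Icc (yl - xu) (yu - xl), ∀ t ∈ Icc (yl - xu) (yu - xl),
        a t - a s = ∫ d in s..t, α d := by
  obtain ⟨K, hK⟩ := hvLip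
  have hloc : ∀ s ∈ Icc (yl - xu) (yu - xl), ∀ t ∈ Icc (yl - xu) (yu - xl), s ≤ t →
      t - s ≤ yu - yl → |(-a) t - (-a) s| ≤ (K + |c|) * (t - s) := by
    intro s hs t ht hst hδ
    -- A firm type for which `s + x` and `t + x` are both admissible skills, available since `t - s
    -- ≤ yu - yl`. Along it `a` inherits the Lipschitz bound of `v`, up to the linear term.
    set x := max (yl - s) xl with hxdef
    have hxI : x ∈ Icc xl xu := ⟨le_max_right _ _, max_le (by linarith [hs.1]) hx.le⟩
    have hsx : yl ≤ s + x := by linarith [le_max_left (yl - s) xl]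
    have htx : t + x ≤ yu := by
      have : x ≤ yu - t := max_le (by linarith) (by linarith [ht.2])
      linarith
    have hsI : s + x ∈ Icc yl yu := ⟨hsx, by linarith⟩
    have htI : t + x ∈ Icc yl yu := ⟨by linarith, htx⟩
    have h1 := hK.dist_le_mul (x, t + x) ⟨hxI, htI⟩ (x, s + x) ⟨hxI, hsI⟩
    simp only [Prod.dist_eq, dist_self, Real.dist_eq] at h1
    rw [hv x hxI _ htI, hv x hxI _ hsI, max_eq_right (abs_nonneg _),
      show t + x - (s + x) = t - s by ring, abs_of_nonneg (sub_nonneg.2 hst),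
      show t + x - x = t by ring, show s + x - x = s by ring] at h1
    have h2 : (-a) t - (-a) s =
        -((a t + b x + c * (t + x)) - (a s + b x + c * (s + x))) + c * (t - s) := by
      simp only [Pi.neg_apply]; ring
    rw [h2]
    refine (abs_add_le _ _).trans ?_
    rw [abs_neg, abs_mul, abs_of_nonneg (sub_nonneg.2 hst)]
    linarith
  have hLip : LipschitzOnWith (K + Real.nnabs c) (-a) (Icc (yl - xu) (yu - xl)) := by
    refine LipschitzOnWith.of_dist_le_mul fun s hs t ht => ?_
    have hδ : 0 < yu - yl := sub_pos.2 hy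
    rw [Real.dist_eq, Real.dist_eq, NNReal.coe_add, Real.coe_nnabs]
    rcases le_total s t with h | h
    · rw [abs_sub_comm, abs_sub_comm s, abs_of_nonneg (sub_nonneg.2 h)]
      exact abs_sub_le_of_local hδ hloc hs ht h
    · rw [abs_of_nonneg (sub_nonneg.2 h)]
      exact abs_sub_le_of_local hδ hloc ht hs h
  obtain ⟨m, hm, hmK, hprim⟩ := exists_monotone_primitive_of_convexOn (by linarith) ha.neg hLip
  refine ⟨fun d => -m d, _, hm.neg, fun d => by rw [abs_neg]; exact hmK d, fun s hs t ht => ?_⟩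
  rw [intervalIntegral.integral_neg, ← hprim s hs t ht]
  simp only [Pi.neg_apply]
  ring

/-- The ironed matching differs from the identity by a bounded amount, hence is onto the line. An
inverse on all of `ℝ` also defines marginal wages at skills in `[yl, yu]` that no firm employs. -/
lemma exists_ironedMatching_inverse (hx : xl < xu) (hy : yl < yu) (F : TypeDist xl xu)
    (G : TypeDist yl yu) : ∃ θ : ℝ → ℝ, StrictMono θ ∧ (∀ x, θ (ironedMatching F G x) = x) ∧
      ∀ z, ironedMatching F G (θ z) = z := by
  have hT := ironedMatching_strictMono hx hy F G
  have h0 : (0 : ℝ) ∈ Icc (0 : ℝ) 1 := by simp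
  have h1 : (1 : ℝ) ∈ Icc (0 : ℝ) 1 := by simp
  have hsurj : Function.Surjective (ironedMatching F G) := by
    refine (ironedMatching_continuous hx hy F G).surjective ?_ ?_
    · refine Filter.tendsto_atTop_mono (fun x => ?_)
        (Filter.tendsto_atTop_add_const_right _ (-ironedGap F G 1) Filter.tendsto_id)
      have := ironedGap_monotoneOn hx hy F G (F.cdf_mem_Icc hx x) h1 (F.cdf_mem_Icc hx x).2
      simp only [ironedMatching, id]
      linarith
    · refine Filter.tendsto_atBot_mono (fun x => ?_)
        (Filter.tendsto_atBot_add_const_right _ (-ironedGap F G 0) Filter.tendsto_id)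
      have := ironedGap_monotoneOn hx hy F G h0 (F.cdf_mem_Icc hx x) (F.cdf_mem_Icc hx x).1
      simp only [ironedMatching, id]
      linarith
  let e := hT.orderIsoOfSurjective _ hsurj
  exact ⟨e.symm, e.symm.strictMono, fun x => e.symm_apply_apply x, fun z => e.apply_symm_apply z⟩

/-- The assignment induced by the ironed matching. -/
def ironedAssignment (F : TypeDist xl xu) (G : TypeDist yl yu) : Measure (ℝ × ℝ) :=
  F.measure.map fun x => (x, ironedMatching F G x)

lemma ironedAssignment_fst (hx : xl < xu) (hy : yl < yu) (F : TypeDist xl xu)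
    (G : TypeDist yl yu) : (ironedAssignment F G).fst = F.measure := by
  have := Measure.fst_map_prodMk (X := fun x : ℝ => x) (μ := F.measure)
    (ironedMatching_continuous hx hy F G).measurable
  rw [ironedAssignment, this, Measure.map_id']

lemma ironedAssignment_snd (F : TypeDist xl xu) (G : TypeDist yl yu) :
    (ironedAssignment F G).snd = F.measure.map (ironedMatching F G) :=
  Measure.snd_map_prodMk measurable_id

/-- The expected shortfall of the ironed matching. -/
lemma integral_cdf_ironedAssignment (hx : xl < xu) (hy : yl < yu) (F : TypeDist xl xu)
    (G : TypeDist yl yu) (h0 : (ironedAssignment F G).snd (Icc yl yu)ᶜ = 0) {y : ℝ}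
    (hyI : y ∈ Icc yl yu) : ∫ s in yl..y, (ironedAssignment F G).snd.real (Iic s) =
      ∫ t in (0 : ℝ)..1, max (y - ironedMatching F G (F.quantile t)) 0 := by
  have : IsFiniteMeasure (ironedAssignment F G).snd := by
    rw [ironedAssignment_snd]; infer_instance
  have hc : Continuous fun z : ℝ => max (y - z) 0 := by fun_prop
  rw [← integral_max_eq h0 hyI, ironedAssignment_snd,
    integral_map (ironedMatching_continuous hx hy F G).measurable.aemeasurable
      hc.aestronglyMeasurable, F.integral_measure_eq hx]

lemma integral_cdf (hy : yl < yu) (G : TypeDist yl yu) {y : ℝ} (hyI : y ∈ Icc yl yu) :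
    ∫ s in yl..y, G.cdf s = ∫ t in (0 : ℝ)..1, max (y - G.quantile t) 0 := by
  rw [← G.integral_measure_eq hy (fun z => max (y - z) 0),
    integral_max_eq G.measure_compl_Icc hyI]
  rfl

lemma ironedAssignment_snd_compl (hx : xl < xu) (hy : yl < yu) (F : TypeDist xl xu)
    (G : TypeDist yl yu) : (ironedAssignment F G).snd (Icc yl yu)ᶜ = 0 := by
  rw [ironedAssignment_snd, Measure.map_apply (ironedMatching_continuous hx hy F G).measurable
    measurableSet_Icc.compl]
  refine measure_mono_null (t := (Icc xl xu)ᶜ) (fun x hxm hxI => hxm ?_) F.measure_compl_Icc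
  exact (isLipschitzMatching_ironedMatching hx hy F G).mapsTo hxI

lemma ironed_quantile_monotoneOn (hx : xl < xu) (hy : yl < yu) (F : TypeDist xl xu)
    (G : TypeDist yl yu) :
    MonotoneOn (fun t => ironedMatching F G (F.quantile t)) (Icc 0 1) := fun _ hs _ ht hst =>
  (ironedMatching_strictMono hx hy F G).monotone
    ((F.quantile_strictMonoOn hx).monotoneOn hs ht hst)

/-- Both sides of the majorization are expected shortfalls, compared by `integral_max_sub_le`. At `y
= yu` the shortfall is linear, so equality of means suffices. -/
lemma isAssignment_ironedAssignment (hx : xl < xu) (hy : yl < yu) (F : TypeDist xl xu)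
    (G : TypeDist yl yu) : IsAssignment F G (ironedAssignment F G) := by
  have hT := isLipschitzMatching_ironedMatching hx hy F G
  have hc := comp_quantile_continuousOn hx F hT.continuousOn
  have h0 := ironedAssignment_snd_compl hx hy F G
  have hp := F.isProbabilityMeasure hx
  refine ⟨?_, ironedAssignment_fst hx hy F G, h0, fun y hyI => ?_, ?_⟩
  · exact Measure.isProbabilityMeasure_map
      (continuous_id.prodMk (ironedMatching_continuous hx hy F G)).measurable.aemeasurable
  · rw [integral_cdf_ironedAssignment hx hy F G h0 hyI, integral_cdf hy G hyI]
    exact integral_max_sub_le (ironed_quantile_monotoneOn hx hy F G) hc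
      (G.quantile_continuousOn hy) (fun t ht => hT.integral_le hx ht) (hT.integral_eq hx) y
  · have hyI := right_mem_Icc.2 hy.le
    have h1 : (1 : ℝ) ∈ Icc (0 : ℝ) 1 := by simp
    rw [integral_cdf_ironedAssignment hx hy F G h0 hyI, integral_cdf hy G hyI]
    have e1 : ∫ t in (0 : ℝ)..1, max (yu - ironedMatching F G (F.quantile t)) 0 =
        ∫ t in (0 : ℝ)..1, (yu - ironedMatching F G (F.quantile t)) := by
      refine intervalIntegral.integral_congr fun t ht => ?_
      rw [uIcc_of_le zero_le_one] at ht
      exact max_eq_left (sub_nonneg.2 (hT.mapsTo (F.quantile_mem hx ht)).2)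
    have e2 : ∫ t in (0 : ℝ)..1, max (yu - G.quantile t) 0 =
        ∫ t in (0 : ℝ)..1, (yu - G.quantile t) := by
      refine intervalIntegral.integral_congr fun t ht => ?_
      rw [uIcc_of_le zero_le_one] at ht
      exact max_eq_left (sub_nonneg.2 (G.quantile_mem hy ht).2)
    rw [e1, e2, intervalIntegral.integral_sub intervalIntegrable_const
      (intervalIntegrable_of_continuousOn_unit hc h1),
      intervalIntegral.integral_sub intervalIntegrable_const
      (intervalIntegrable_of_continuousOn_unit (G.quantile_continuousOn hy) h1),
      hT.integral_eq hx]

/-- Between two points of the image of the ironed matching at which the distance to the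
diagonal differs, there is a level at which the integrated distribution functions agree. -/
lemma exists_integral_cdf_eq (hx : xl < xu) (hy : yl < yu) (F : TypeDist xl xu)
    (G : TypeDist yl yu) {x x' : ℝ} (hxx' : x < x')
    (hne : ironedGap F G (F.cdf x) ≠ ironedGap F G (F.cdf x')) :
    ∃ k ∈ Icc (ironedMatching F G x) (ironedMatching F G x'),
      ∫ s in yl..k, (ironedAssignment F G).snd.real (Iic s) = ∫ s in yl..k, G.cdf s := by
  have hcx := F.cdf_mem_Icc hx x
  have hcx' := F.cdf_mem_Icc hx x'
  have he := quantileDiff_continuousOn hx hy F G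
  have hE := quantileGap_hasDerivWithinAt hx hy F G
  -- Without a contact point in between, `ē` would be constant.
  obtain ⟨t, ht, hcon⟩ : ∃ t ∈ Ioo (F.cdf x) (F.cdf x'),
      convexEnvelope (quantileGap F G) t = quantileGap F G t := by
    by_contra! h
    exact hne (envelopeDeriv_eq_of_no_contact he hE hcx hcx' (F.cdf_monotone hxx'.le) h)
  have htI : t ∈ Ioo (0 : ℝ) 1 := ⟨hcx.1.trans_lt ht.1, ht.2.trans_le hcx'.2⟩
  have htI' := Ioo_subset_Icc_self htI
  have hiron : ironedGap F G t = F.quantile t - G.quantile t :=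
    envelopeDeriv_eq_of_contact he hE htI hcon
  have hTq : ironedMatching F G (F.quantile t) = G.quantile t := by
    rw [ironedMatching_quantile hx F G htI', hiron]; ring
  have hmono := (ironedMatching_strictMono hx hy F G).monotone
  have hq := G.quantile_mem hy htI'
  refine ⟨G.quantile t, ⟨?_, ?_⟩, ?_⟩
  · rw [← hTq]
    refine hmono (le_of_lt ?_)
    by_contra! hcon'
    have := F.cdf_monotone hcon'
    rw [F.cdf_quantile hx htI'] at this
    exact this.not_gt ht.1
  · rw [← hTq]
    refine hmono (le_of_lt ?_)
    by_contra! hcon'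
    have := F.cdf_monotone hcon'
    rw [F.cdf_quantile hx htI'] at this
    exact this.not_gt ht.2
  -- At a contact point the ironed matching and `G` have the same `t`-quantile, so one threshold
  -- cuts both at `t`; the shortfalls reduce to primitives, which agree because the envelope touches
  -- `E`.
  · rw [integral_cdf_ironedAssignment hx hy F G (ironedAssignment_snd_compl hx hy F G) hq,
      integral_cdf hy G hq, integral_max_sub_self (G.quantile_strictMonoOn hy).monotoneOn htI']
    have := integral_max_sub_self (ironed_quantile_monotoneOn hx hy F G) htI'
    rw [hTq] at this
    rw [this, integral_ironedMatching_quantile hx hy F G htI', hcon,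
      quantileGap_eq hx hy F G htI']
    ring

/-- A measure that lives on the graph of a continuous map and whose first marginal has full
support is supported exactly on the graph. -/
lemma support_eq_graphOn (hx : xl < xu) {F : TypeDist xl xu} {J : Measure (ℝ × ℝ)}
    {T : ℝ → ℝ} (hT : Continuous T) (hfst : J.fst = F.measure)
    (hsub : J.support ⊆ (Icc xl xu).graphOn T) : J.support = (Icc xl xu).graphOn T := by
  refine hsub.antisymm ?_
  rintro _ ⟨x, hxI, rfl⟩
  by_contra hns
  obtain ⟨U, hU, hU0⟩ := Measure.notMem_support_iff_exists.1 hns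
  obtain ⟨A, B, hA, hxA, hB, hTB, hAB⟩ := mem_nhds_prod_iff'.1 hU
  -- The part of the graph over `O` lies in the null set `U`, and `J` lives on the graph, so the
  -- strip over `O` would be null although `F` charges `O`.
  set O : Set ℝ := A ∩ T ⁻¹' B with hO
  have hOo : IsOpen O := hA.inter (hB.preimage hT)
  have hpos := F.measure_pos_of_isOpen hx hOo hxI ⟨hxA, hTB⟩
  rw [← hfst, Measure.fst_apply hOo.measurableSet] at hpos
  refine hpos.ne' (measure_mono_null (t := U ∪ J.supportᶜ) ?_ ?_)
  · intro w hw
    by_cases hws : w ∈ J.support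
    · left
      obtain ⟨y, hy, rfl⟩ := hsub hws
      exact hAB ⟨hw.1, hw.2⟩
    · exact Or.inr hws
  · exact measure_union_null hU0 Measure.measure_compl_support

lemma ironedAssignment_support (hx : xl < xu) (hy : yl < yu) (F : TypeDist xl xu)
    (G : TypeDist yl yu) :
    (ironedAssignment F G).support = (Icc xl xu).graphOn (ironedMatching F G) := by
  have hT := ironedMatching_continuous hx hy F G
  have hcl : IsClosed ((Icc xl xu).graphOn (ironedMatching F G)) :=
    (isCompact_Icc.image (continuous_id.prodMk hT)).isClosed
  refine support_eq_graphOn hx hT (ironedAssignment_fst hx hy F G)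
    (Measure.support_subset_of_isClosed hcl ?_)
  rw [ironedAssignment, mem_ae_map_iff (continuous_id'.prodMk hT).measurable.aemeasurable
    hcl.measurableSet]
  filter_upwards [F.ae_mem_Icc] with x hxI using ⟨x, hxI, rfl⟩

/-- The ironed matching is supported by equilibrium prices. -/
lemma exists_equilibrium (hx : xl < xu) (hy : yl < yu) (F : TypeDist xl xu) (G : TypeDist yl yu)
    {v : ℝ → ℝ → ℝ} {a b : ℝ → ℝ} {c : ℝ}
    (ha : ConcaveOn ℝ (Icc (yl - xu) (yu - xl)) a)
    (hv : ∀ x ∈ Icc xl xu, ∀ z ∈ Icc yl yu, v x z = a (z - x) + b x + c * z)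
    (hvLip : ∃ K, LipschitzOnWith K (fun w : ℝ × ℝ => v w.1 w.2) (Icc xl xu ×ˢ Icc yl yu)) :
    ∃ p q : ℝ → ℝ, IsCompetitiveEquilibrium F G v (ironedAssignment F G) p q := by
  obtain ⟨α, K, hα, hαK, hprim⟩ := exists_antitone_primitive hx hy ha hv hvLip
  obtain ⟨θ, hθ, hθT, hTθ⟩ := exists_ironedMatching_inverse hx hy F G
  obtain ⟨Kv, hKv⟩ := hvLip
  set T := ironedMatching F G with hTdef
  have hT := isLipschitzMatching_ironedMatching hx hy F G
  have hTmono := ironedMatching_strictMono hx hy F G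
  have hA := isAssignment_ironedAssignment hx hy F G
  have hgap : ∀ z, z - θ z = -ironedGap F G (F.cdf (θ z)) := fun z => by
    have := hTθ z
    rw [hTdef, ironedMatching] at this
    linarith
  -- The marginal product of skill `z` at its own firm `θ z`; as a wage density it makes that firm's
  -- first-order condition hold.
  set m : ℝ → ℝ := fun z => α (z - θ z) + c with hm
  have hmmono : Monotone m := by
    intro y z hyz
    have h1 := ironedMatching_sub_le hx hy F G (hθ.monotone hyz)
    rw [← hTdef, hTθ, hTθ] at h1
    have h2 : z - θ z ≤ y - θ y := by linarith
    have h3 := hα h2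
    simp only [hm]
    linarith
  have hmK : ∀ z, |m z| ≤ K + |c| := fun z => (abs_add_le _ _).trans (by
    linarith [hαK (z - θ z)])
  have hmi : ∀ y z, IntervalIntegrable m volume y z := fun y z => hmmono.intervalIntegrable
  set q : ℝ → ℝ := fun z => ∫ s in yl..z, m s with hq
  have hqsub : ∀ y z, q z - q y = ∫ s in y..z, m s := fun y z =>
    intervalIntegral.integral_interval_sub_left (hmi _ _) (hmi _ _)
  set p : ℝ → ℝ := fun x => v x (T x) - q (T x) with hp
  have hK0 : 0 ≤ K + |c| := (abs_nonneg _).trans (hmK 0)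
  have hqL : ∀ y z, |q y - q z| ≤ (K + |c|) * |y - z| := fun y z => by
    rw [hqsub]
    exact intervalIntegral.norm_integral_le_of_norm_le_const (f := m) fun s _ => hmK s
  refine ⟨p, q, hA, ⟨Kv + (K + |c|).toNNReal, ?_⟩, ⟨(K + |c|).toNNReal, ?_⟩, ?_, ?_,
    convexOn_primitive_of_monotoneOn (hmmono.monotoneOn _), ?_⟩
  · refine LipschitzOnWith.of_dist_le_mul fun x hxI y hyI => ?_
    have h1 := hKv.dist_le_mul (x, T x) ⟨hxI, hT.mapsTo hxI⟩ (y, T y) ⟨hyI, hT.mapsTo hyI⟩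
    have h2 := hT.lipschitz.dist_le_mul x hxI y hyI
    rw [NNReal.coe_one, one_mul] at h2
    rw [Prod.dist_eq, max_eq_left h2] at h1
    simp only [Real.dist_eq] at h1 h2 ⊢
    have h3 := (hqL (T x) (T y)).trans (mul_le_mul_of_nonneg_left h2 hK0)
    rw [NNReal.coe_add, Real.coe_toNNReal _ hK0, add_mul]
    have h4 : p x - p y = (v x (T x) - v y (T y)) - (q (T x) - q (T y)) := by
      simp only [hp]; ring
    rw [h4]
    exact (abs_sub _ _).trans (add_le_add h1 h3)
  · refine LipschitzOnWith.of_dist_le_mul fun y _ z _ => ?_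
    rw [Real.coe_toNNReal _ hK0, Real.dist_eq, Real.dist_eq]
    exact hqL y z
  · intro w hw
    rw [ironedAssignment_support hx hy F G] at hw
    obtain ⟨x, _, rfl⟩ := hw
    simp only [hp]
    ring
  · intro x hxI z hzI
    have hTI := hT.mapsTo hxI
    have hD : ∀ z ∈ Icc yl yu, z - x ∈ Icc (yl - xu) (yu - xl) := fun z hz =>
      ⟨by linarith [hz.1, hxI.2], by linarith [hz.2, hxI.1]⟩
    have h1 := hprim _ (hD _ hTI) _ (hD z hzI)
    have h2 : ∫ s in T x..z, (α (s - x) + c) = v x z - v x (T x) := by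
      have hi : IntervalIntegrable (fun s => α (s - x)) volume (T x) z :=
        (hα.comp_monotone fun s t h => sub_le_sub_right h x).intervalIntegrable
      rw [intervalIntegral.integral_add hi intervalIntegrable_const,
        intervalIntegral.integral_comp_sub_right (fun d => α d) x, ← h1, hv x hxI z hzI,
        hv x hxI _ hTI]
      simp
      ring
    have h2i : ∀ y z, IntervalIntegrable (fun s => α (s - x) + c) volume y z := fun y z =>
      ((hα.comp_monotone fun s t h => sub_le_sub_right h x).intervalIntegrable).add
        intervalIntegrable_const
    suffices v x z - v x (T x) ≤ q z - q (T x) by simp only [hp]; linarith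
    rw [← h2, hqsub]
    -- For `s` above `T x` the firm `θ s` is at least `x`, so the marginal wage is at least the
    -- marginal product at `x`; below `T x` the comparison reverses. Hence `T x` is optimal for `x`.
    rcases le_total (T x) z with h | h
    · refine intervalIntegral.integral_mono_on h (h2i _ _) (hmi _ _) fun s hs => ?_
      have : x ≤ θ s := by rw [← hθT x]; exact hθ.monotone hs.1
      simp only [hm]
      linarith [hα (show s - θ s ≤ s - x by linarith)]
    · rw [intervalIntegral.integral_symm, intervalIntegral.integral_symm z, neg_le_neg_iff]
      refine intervalIntegral.integral_mono_on h (hmi _ _) (h2i _ _) fun s hs => ?_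
      have : θ s ≤ x := by rw [← hθT x]; exact hθ.monotone hs.2
      simp only [hm]
      linarith [hα (show s - x ≤ s - θ s by linarith)]
  · have hJ := hA.isProbabilityMeasure
    refine integral_primitive_eq hy hA.snd_compl hA.majorizes hmmono hmK
      fun y _ z _ hyz hne => ?_
    -- Marginal wages depend on `z` only through `ē(F(θ z))`, so a change in them forces a change of
    -- `ē`.
    obtain ⟨k, hk, hk'⟩ := exists_integral_cdf_eq hx hy F G (hθ hyz) (fun h => hne (by
      simp only [hm]; rw [hgap, hgap, h]))
    rw [← hTdef, hTθ, hTθ] at hk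
    exact ⟨k, hk, hk'⟩

/-! ### Uniqueness by duality -/

variable {F : TypeDist xl xu} {G : TypeDist yl yu} {J : Measure (ℝ × ℝ)}
  {v : ℝ → ℝ → ℝ} {p q : ℝ → ℝ}

lemma IsAssignment.ae_mem (h : IsAssignment F G J) : ∀ᵐ w ∂J, w ∈ Icc xl xu ×ˢ Icc yl yu := by
  have h1 : ∀ᵐ w ∂J, w.1 ∈ Icc xl xu := by
    have := F.ae_mem_Icc
    rw [← h.fst_eq] at this
    exact ae_of_ae_map measurable_fst.aemeasurable this
  have h2 : ∀ᵐ w ∂J, w.2 ∈ Icc yl yu := by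
    have : ∀ᵐ z ∂J.snd, z ∈ Icc yl yu :=
      (measure_eq_zero_iff_ae_notMem.1 h.snd_compl).mono fun _ hx => by simpa using hx
    exact ae_of_ae_map measurable_snd.aemeasurable this
  filter_upwards [h1, h2] with w hw1 hw2 using ⟨hw1, hw2⟩

lemma IsAssignment.support_subset (h : IsAssignment F G J) :
    J.support ⊆ Icc xl xu ×ˢ Icc yl yu :=
  Measure.support_subset_of_isClosed (isClosed_Icc.prod isClosed_Icc) h.ae_mem

lemma IsAssignment.integrable (h : IsAssignment F G J) {f : ℝ × ℝ → ℝ}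
    (hf : ContinuousOn f (Icc xl xu ×ˢ Icc yl yu)) : Integrable f J := by
  have := h.isProbabilityMeasure
  rw [← Measure.restrict_eq_self_of_ae_mem h.ae_mem]
  exact hf.integrableOn_compact (isCompact_Icc.prod isCompact_Icc)

lemma continuousOn_comp_fst (hp : ContinuousOn p (Icc xl xu)) :
    ContinuousOn (fun w : ℝ × ℝ => p w.1) (Icc xl xu ×ˢ Icc yl yu) :=
  hp.comp continuous_fst.continuousOn fun _ hw => hw.1

lemma continuousOn_comp_snd (hq : ContinuousOn q (Icc yl yu)) :
    ContinuousOn (fun w : ℝ × ℝ => q w.2) (Icc xl xu ×ˢ Icc yl yu) :=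
  hq.comp continuous_snd.continuousOn fun _ hw => hw.2

lemma IsAssignment.integral_add (h : IsAssignment F G J) (hp : ContinuousOn p (Icc xl xu))
    (hq : ContinuousOn q (Icc yl yu)) :
    ∫ w, (p w.1 + q w.2) ∂J = ∫ x, p x ∂F.measure + ∫ z, q z ∂J.snd := by
  rw [MeasureTheory.integral_add (h.integrable (continuousOn_comp_fst hp))
    (h.integrable (continuousOn_comp_snd hq)), ← h.fst_eq]
  congr 1
  · refine (integral_map measurable_fst.aemeasurable ?_).symm
    change AEStronglyMeasurable p J.fst
    rw [h.fst_eq, ← F.restrict_Icc]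
    exact hp.aestronglyMeasurable measurableSet_Icc
  · refine (integral_map measurable_snd.aemeasurable ?_).symm
    change AEStronglyMeasurable q J.snd
    have : ∀ᵐ z ∂J.snd, z ∈ Icc yl yu :=
      (measure_eq_zero_iff_ae_notMem.1 h.snd_compl).mono fun _ hx => by simpa using hx
    rw [← Measure.restrict_eq_self_of_ae_mem this]
    exact hq.aestronglyMeasurable measurableSet_Icc

lemma IsCompetitiveEquilibrium.continuousOn_fst (h : IsCompetitiveEquilibrium F G v J p q) :
    ContinuousOn p (Icc xl xu) := h.lipschitz_p.choose_spec.continuousOn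

lemma IsCompetitiveEquilibrium.continuousOn_snd (h : IsCompetitiveEquilibrium F G v J p q) :
    ContinuousOn q (Icc yl yu) := h.lipschitz_q.choose_spec.continuousOn

/-- The value of an equilibrium assignment equals the value of its prices. -/
lemma IsCompetitiveEquilibrium.integral_eq (h : IsCompetitiveEquilibrium F G v J p q) :
    ∫ w, v w.1 w.2 ∂J = ∫ x, p x ∂F.measure + ∫ y, q y ∂G.measure := by
  rw [← h.wages_eq, ← h.isAssignment.integral_add h.continuousOn_fst h.continuousOn_snd]
  have hs : ∀ᵐ w ∂J, w ∈ J.support := Measure.support_mem_ae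
  exact integral_congr_ae (hs.mono fun w hw => (h.eq_on_support w hw).symm)

/-- Equilibrium prices bound the payments under every assignment. -/
lemma IsCompetitiveEquilibrium.integral_prices_le (hy : yl < yu) {J' : Measure (ℝ × ℝ)}
    (h : IsCompetitiveEquilibrium F G v J p q) (hJ' : IsAssignment F G J') :
    ∫ w, (p w.1 + q w.2) ∂J' ≤ ∫ x, p x ∂F.measure + ∫ y, q y ∂G.measure := by
  obtain ⟨L, hL⟩ := h.lipschitz_q
  have := hJ'.isProbabilityMeasure
  rw [hJ'.integral_add h.continuousOn_fst h.continuousOn_snd]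
  have := integral_convexOn_le hy hJ'.snd_compl hJ'.majorizes h.convex_q hL
  linarith

/-- The prices of one equilibrium support the assignment of every other equilibrium. -/
lemma IsCompetitiveEquilibrium.eq_on_support_of_equilibrium (hy : yl < yu)
    {J' : Measure (ℝ × ℝ)} {p' q' : ℝ → ℝ}
    (hv : ContinuousOn (fun w : ℝ × ℝ => v w.1 w.2) (Icc xl xu ×ˢ Icc yl yu))
    (h : IsCompetitiveEquilibrium F G v J p q) (h' : IsCompetitiveEquilibrium F G v J' p' q') :
    ∀ w ∈ J'.support, p w.1 + q w.2 = v w.1 w.2 := by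
  have hpq : ContinuousOn (fun w : ℝ × ℝ => p w.1 + q w.2) (Icc xl xu ×ˢ Icc yl yu) :=
    (continuousOn_comp_fst h.continuousOn_fst).add (continuousOn_comp_snd h.continuousOn_snd)
  have hpq' : ContinuousOn (fun w : ℝ × ℝ => p' w.1 + q' w.2) (Icc xl xu ×ˢ Icc yl yu) :=
    (continuousOn_comp_fst h'.continuousOn_fst).add (continuousOn_comp_snd h'.continuousOn_snd)
  have hA := h.isAssignment
  have hA' := h'.isAssignment
  -- Both equilibria attain the same total value, so the nonnegative slack `p + q - v` integrates to
  -- zero under `J'`.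
  have hle : ∫ w, (p w.1 + q w.2) ∂J' ≤ ∫ w, v w.1 w.2 ∂J' := by
    calc ∫ w, (p w.1 + q w.2) ∂J' ≤ ∫ w, v w.1 w.2 ∂J := by
          rw [h.integral_eq]; exact h.integral_prices_le hy hA'
      _ ≤ ∫ w, (p' w.1 + q' w.2) ∂J := by
          refine integral_mono_ae (hA.integrable hv) (hA.integrable hpq') ?_
          exact hA.ae_mem.mono fun w hw => h'.le_everywhere _ hw.1 _ hw.2
      _ ≤ ∫ w, v w.1 w.2 ∂J' := by
          rw [h'.integral_eq]; exact h'.integral_prices_le hy hA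
  have hD : ContinuousOn (fun w : ℝ × ℝ => p w.1 + q w.2 - v w.1 w.2)
      (Icc xl xu ×ˢ Icc yl yu) := hpq.sub hv
  have hnn : 0 ≤ᵐ[J'] fun w => p w.1 + q w.2 - v w.1 w.2 :=
    hA'.ae_mem.mono fun w hw => sub_nonneg.2 (h.le_everywhere _ hw.1 _ hw.2)
  have hzero : ∫ w, (p w.1 + q w.2 - v w.1 w.2) ∂J' = 0 := by
    refine le_antisymm ?_ (integral_nonneg_of_ae hnn)
    rw [integral_sub (hA'.integrable hpq) (hA'.integrable hv)]
    linarith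
  have hae := (integral_eq_zero_iff_of_nonneg_ae hnn (hA'.integrable hD)).1 hzero
  -- Continuity upgrades an almost sure equality to one on the whole support.
  have hcl : IsClosed {w ∈ Icc xl xu ×ˢ Icc yl yu | p w.1 + q w.2 - v w.1 w.2 = 0} :=
    hD.preimage_isClosed_of_isClosed (isClosed_Icc.prod isClosed_Icc) isClosed_singleton
  intro w hw
  have := Measure.support_subset_of_isClosed hcl
    (by filter_upwards [hae, hA'.ae_mem] with w h1 h2 using ⟨h2, h1⟩) hw
  exact sub_eq_zero.1 this.2

/-- Every firm type has a unique optimal partner at convex wages. -/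
lemma IsCompetitiveEquilibrium.partner_unique {a b : ℝ → ℝ} {c : ℝ}
    (ha : StrictConcaveOn ℝ (Icc (yl - xu) (yu - xl)) a)
    (hv : ∀ x ∈ Icc xl xu, ∀ z ∈ Icc yl yu, v x z = a (z - x) + b x + c * z)
    (h : IsCompetitiveEquilibrium F G v J p q) {x z z' : ℝ} (hxI : x ∈ Icc xl xu)
    (hz : z ∈ Icc yl yu) (hz' : z' ∈ Icc yl yu) (he : p x + q z = v x z)
    (he' : p x + q z' = v x z') : z = z' := by
  by_contra hne
  have hD : ∀ z ∈ Icc yl yu, z - x ∈ Icc (yl - xu) (yu - xl) := fun z hz =>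
    ⟨by linarith [hz.1, hxI.2], by linarith [hz.2, hxI.1]⟩
  have hhalf : (0 : ℝ) < 1 / 2 := by norm_num
  -- With two optimal partners, their midpoint would give firm `x` strictly more than `p x`.
  have h1 := ha.2 (hD z hz) (hD z' hz') (fun h => hne (by linarith)) hhalf hhalf (by norm_num)
  have h2 := h.convex_q.2 hz hz' hhalf.le hhalf.le (by norm_num)
  have hm : (1 / 2 : ℝ) * z + 1 / 2 * z' ∈ Icc yl yu :=
    ⟨by linarith [hz.1, hz'.1], by linarith [hz.2, hz'.2]⟩
  have h3 := h.le_everywhere x hxI _ hm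
  simp only [smul_eq_mul] at h1 h2
  rw [hv x hxI _ hm] at h3
  rw [hv x hxI z hz] at he
  rw [hv x hxI z' hz'] at he'
  rw [show (1 / 2 : ℝ) * (z - x) + 1 / 2 * (z' - x) = 1 / 2 * z + 1 / 2 * z' - x by ring] at h1
  linarith

/-- In the convex-loss case every equilibrium assignment is supported on the graph of the ironed
matching. -/
lemma IsCompetitiveEquilibrium.support_eq (hx : xl < xu) (hy : yl < yu) {a b : ℝ → ℝ} {c : ℝ}
    (ha : StrictConcaveOn ℝ (Icc (yl - xu) (yu - xl)) a)
    (hv : ∀ x ∈ Icc xl xu, ∀ z ∈ Icc yl yu, v x z = a (z - x) + b x + c * z)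
    (hvLip : ∃ K, LipschitzOnWith K (fun w : ℝ × ℝ => v w.1 w.2) (Icc xl xu ×ˢ Icc yl yu))
    (h : IsCompetitiveEquilibrium F G v J p q) :
    J.support = (Icc xl xu).graphOn (ironedMatching F G) := by
  obtain ⟨p', q', h'⟩ := exists_equilibrium hx hy F G ha.concaveOn hv hvLip
  refine support_eq_graphOn hx (ironedMatching_continuous hx hy F G) h.isAssignment.fst_eq ?_
  intro w hw
  have hwI := h.isAssignment.support_subset hw
  have hT := (isLipschitzMatching_ironedMatching hx hy F G).mapsTo hwI.1
  -- The prices of the ironed equilibrium make both `w.2` and the ironed partner optimal for `w.1`.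
  have h1 := h'.eq_on_support_of_equilibrium hy hvLip.choose_spec.continuousOn h w hw
  have h2 := h'.eq_on_support (w.1, ironedMatching F G w.1) (by
    rw [ironedAssignment_support hx hy F G]; exact ⟨w.1, hwI.1, rfl⟩)
  have h3 := h'.partner_unique ha hv hwI.1 hT hwI.2 h2 h1
  exact ⟨w.1, hwI.1, Prod.ext rfl h3⟩

lemma isEquilibriumMatching_iff (hx : xl < xu) (hy : yl < yu) (F : TypeDist xl xu)
    (G : TypeDist yl yu) {a b : ℝ → ℝ} {c : ℝ}
    (ha : StrictConcaveOn ℝ (Icc (yl - xu) (yu - xl)) a)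
    (hv : ∀ x ∈ Icc xl xu, ∀ z ∈ Icc yl yu, v x z = a (z - x) + b x + c * z)
    (hvLip : ∃ K, LipschitzOnWith K (fun w : ℝ × ℝ => v w.1 w.2) (Icc xl xu ×ˢ Icc yl yu))
    (T : ℝ → ℝ) :
    IsEquilibriumMatching F G v T ↔ EqOn T (ironedMatching F G) (Icc xl xu) := by
  constructor
  · rintro ⟨J, p, q, h, hs⟩
    rw [h.support_eq hx hy ha hv hvLip] at hs
    intro x hxI
    have : (x, T x) ∈ (Icc xl xu).graphOn (ironedMatching F G) := by
      rw [hs]; exact ⟨x, hxI, rfl⟩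
    obtain ⟨y, _, hy'⟩ := this
    obtain ⟨rfl, h2⟩ := Prod.ext_iff.1 hy'
    exact h2.symm
  · intro h
    obtain ⟨p, q, h'⟩ := exists_equilibrium hx hy F G ha.concaveOn hv hvLip
    refine ⟨_, p, q, h', ?_⟩
    rw [ironedAssignment_support hx hy F G]
    exact image_congr fun x hxI => by rw [h hxI]

end Matching
end

theorem mainTheorem11 {xl xu yl yu : ℝ} (hx : xl < xu) (hy : yl < yu)
    (F : Matching.TypeDist xl xu) (G : Matching.TypeDist yl yu)
    (v : ℝ → ℝ → ℝ) (a b : ℝ → ℝ) (c : ℝ)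
    (ha : StrictConcaveOn ℝ (Set.Icc (yl - xu) (yu - xl)) a)
    (hv : ∀ x ∈ Set.Icc xl xu, ∀ z ∈ Set.Icc yl yu, v x z = a (z - x) + b x + c * z)
    (hvLip : ∃ K, LipschitzOnWith K (fun w : ℝ × ℝ => v w.1 w.2)
      (Set.Icc xl xu ×ˢ Set.Icc yl yu)) :
    -- there is exactly one equilibrium matching, and every equilibrium is given by it
    (∃ T : ℝ → ℝ, Matching.IsEquilibriumMatching F G v T ∧
      (∀ T' : ℝ → ℝ, Matching.IsEquilibriumMatching F G v T' → Set.EqOn T' T (Set.Icc xl xu)) ∧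
      ∀ (J : MeasureTheory.Measure (ℝ × ℝ)) (p q : ℝ → ℝ),
        Matching.IsCompetitiveEquilibrium F G v J p q →
          J.support = (Set.Icc xl xu).graphOn T) ∧
    -- the convex envelope is continuously differentiable on the unit interval
    DifferentiableOn ℝ (Matching.convexEnvelope (Matching.quantileGap F G)) (Set.Icc 0 1) ∧
    ContinuousOn (Matching.ironedGap F G) (Set.Icc 0 1) ∧
    -- the three characterizations
    ∀ T : ℝ → ℝ,
      (Matching.IsEquilibriumMatching F G v T ↔
        Matching.IsLipschitzMatching F G T ∧
          ∀ x ∈ Matching.compressionSet F G T, HasDerivAt T 1 x) ∧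
      (Matching.IsEquilibriumMatching F G v T ↔
        ∀ x ∈ Set.Icc xl xu, T x = x - Matching.ironedGap F G (F.cdf x)) ∧
      (Matching.IsEquilibriumMatching F G v T ↔
        Matching.IsLipschitzMatching F G T ∧
          ∀ T' : ℝ → ℝ, Matching.IsLipschitzMatching F G T' →
            Matching.Majorizes 0 1 (T ∘ F.quantile) (T' ∘ F.quantile)) := by
  have key := Matching.isEquilibriumMatching_iff hx hy F G ha hv hvLip
  refine ⟨⟨Matching.ironedMatching F G, (key _).2 fun _ _ => rfl, fun T' hT' => (key T').1 hT',
    fun J p q h => h.support_eq hx hy ha hv hvLip⟩,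
    Matching.differentiableOn_convexEnvelope (Matching.quantileDiff_continuousOn hx hy F G)
      (Matching.quantileGap_hasDerivWithinAt hx hy F G),
    Matching.ironedGap_continuousOn hx hy F G, fun T => ⟨?_, ?_, ?_⟩⟩
  · exact (key T).trans (Matching.eqOn_ironedMatching_iff_hasDerivAt hx hy F G T)
  · exact key T
  · exact (key T).trans (Matching.eqOn_ironedMatching_iff_majorizes hx hy F G T)
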